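/- Monoids are regarded as semigroups, and identities are pairs $u\approx v$ of nonempty words over a countably infinite alphabet $\mathfrak A$ of variables. A semigroup is *finitely based* (FB) if all its identities can be deduced from a finite set of its identities, and *non-finitely based* (NFB) otherwise. A word $u$ is an *isoterm* for a monoid $M$ if $u=v$ (as words) whenever $M$ satisfies $u\approx v$; $\mathrm{iso}(M)\subseteq\mathfrak A^*$ denotes the set of all isoterms for $M$ (the empty word included). For a set of words $W\subseteq\mathfrak A^*$, let $S^1(W)$ be the Rees quotient of the free monoid $\mathfrak A^*$ over the ideal of all words that are not (contiguous) subwords of words in $W$. The set $W$ is called FB if the monoid $S^1(W)$ is FB, and two sets of words $W,W'$ are *equationally equivalent*, $W\sim W'$, if $S^1(W)$ and $S^1(W')$ generate the same variety of semigroups. For $\ell\ge 2$ let $$L_\ell=\langle a,b\mid aa=a,\ bb=b,\ \underbrace{ababab\cdots}_{\text{length }\ell}=0\rangle$$ (a presentation of a semigroup with zero), and let $L_\ell^1$ be the monoid obtained from $L_\ell$ by adjoining an identity element. **Corollary.** The monoids $L_3^1$ and $L_5^1$ are non-finitely based, while the sets of words $\mathrm{iso}(L_3^1)$ and $\mathrm{iso}(L_5^1)$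 are finitely based. Moreover, $$\mathrm{iso}(L_3^1)\sim\{ab\}\qquad\text{and}\qquad \mathrm{iso}(L_5^1)\sim\{abab,\ a^2b^2,\ ab^2a\},$$ where $a,b$ are distinct variables. -/

import Mathlib

namespace Lee

/-! ### Words, identities and the finite basis property

Variables are natural numbers. `FreeSemigroup ℕ` is the set of nonempty words,
`FreeMonoid ℕ` the set of all words. Monoids are regarded as semigroups. -/

/-- The semigroup `S` satisfies the identity `u ≈ v`. -/
def Satisfies (S : Type*) [Semigroup S] (u v : FreeSemigroup ℕ) : Prop :=
  ∀ θ : ℕ → S, FreeSemigroup.lift θ u = FreeSemigroup.lift θ v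

/-- One substitution instance of an identity from the set `E`. -/
def SubstInstance (E : Set (FreeSemigroup ℕ × FreeSemigroup ℕ)) (u v : FreeSemigroup ℕ) : Prop :=
  ∃ p ∈ E, ∃ θ : ℕ → FreeSemigroup ℕ,
    u = FreeSemigroup.lift θ p.1 ∧ v = FreeSemigroup.lift θ p.2

/-- The identity `u ≈ v` can be deduced from the set `E` of identities: it belongs to the
congruence generated by all substitution instances of members of `E` (that is, it is obtained
by equational logic: reflexivity, symmetry, transitivity, multiplication and substitution). -/
def Deducible (E : Set (FreeSemigroup ℕ × FreeSemigroup ℕ)) (u v : FreeSemigroup ℕ) : Prop :=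
  conGen (SubstInstance E) u v

/-- `S` is finitely based: all identities of `S` can be deduced from a finite set of
identities of `S`. -/
def FinitelyBased (S : Type*) [Semigroup S] : Prop :=
  ∃ E : Set (FreeSemigroup ℕ × FreeSemigroup ℕ), E.Finite ∧
    (∀ p ∈ E, Satisfies S p.1 p.2) ∧
    ∀ u v : FreeSemigroup ℕ, Satisfies S u v → Deducible E u v

/-! ### Varieties -/

/-- A variety of semigroups: the class of all semigroups satisfying some set of identities. -/
def IsVariety (K : Set Semigrp.{0}) : Prop :=
  ∃ E : Set (FreeSemigroup ℕ × FreeSemigroup ℕ), K = {T | ∀ p ∈ E, Satisfies T.carrier p.1 p.2}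

/-- The variety of semigroups generated by `S`: the smallest variety containing `S`. -/
def var (S : Type) [Semigroup S] : Set Semigrp.{0} :=
  ⋂₀ {K | IsVariety K ∧ Semigrp.of S ∈ K}

/-! ### The monoids `S¹(W)` -/

/-- `u` is a (contiguous) subword of some word in `W`. -/
def IsSubwordOf (W : Set (FreeMonoid ℕ)) (u : FreeMonoid ℕ) : Prop :=
  ∃ w ∈ W, ∃ p q : FreeMonoid ℕ, w = p * u * q

theorem IsSubwordOf.left {W : Set (FreeMonoid ℕ)} {u v : FreeMonoid ℕ}
    (h : IsSubwordOf W (u * v)) : IsSubwordOf W u := by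
  obtain ⟨w, hw, p, q, rfl⟩ := h
  exact ⟨_, hw, p, v * q, by simp only [mul_assoc]⟩

theorem IsSubwordOf.right {W : Set (FreeMonoid ℕ)} {u v : FreeMonoid ℕ}
    (h : IsSubwordOf W (u * v)) : IsSubwordOf W v := by
  obtain ⟨w, hw, p, q, rfl⟩ := h
  exact ⟨_, hw, p * u, q, by simp only [mul_assoc]⟩

/-- The Rees congruence of the ideal of all words that are not subwords of words in `W`. -/
def reesCon (W : Set (FreeMonoid ℕ)) : Con (FreeMonoid ℕ) where
  r u v := u = v ∨ (¬ IsSubwordOf W u ∧ ¬ IsSubwordOf W v)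
  iseqv :=
    { refl := fun _ => Or.inl rfl
      symm := by
        rintro u v (h | h)
        · exact Or.inl h.symm
        · exact Or.inr h.symm
      trans := by
        rintro u v w (rfl | h) (rfl | h')
        · exact Or.inl rfl
        · exact Or.inr h'
        · exact Or.inr h
        · exact Or.inr ⟨h.1, h'.2⟩ }
  mul' := by
    rintro u v u' v' (rfl | h) (rfl | h')
    · exact Or.inl rfl
    · exact Or.inr ⟨fun k => h'.1 k.right, fun k => h'.2 k.right⟩
    · exact Or.inr ⟨fun k => h.1 k.left, fun k => h.2 k.left⟩
    · exact Or.inr ⟨fun k => h.1 k.left, fun k => h.2 k.left⟩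

/-- The Rees quotient `S¹(W)`; its nonzero elements are the subwords of words in `W`. -/
abbrev ReesMonoid (W : Set (FreeMonoid ℕ)) : Type := (reesCon W).Quotient

/-- The set of words `W` is finitely based: the monoid `S¹(W)` is. -/
def FinitelyBasedWords (W : Set (FreeMonoid ℕ)) : Prop := FinitelyBased (ReesMonoid W)

/-- Equational equivalence `W ∼ W'` of sets of words. -/
def EquationallyEquivalent (W W' : Set (FreeMonoid ℕ)) : Prop :=
  var (ReesMonoid W) = var (ReesMonoid W')

/-! ### Isoterms -/

/-- `u` is an isoterm for `S`: if `S` satisfies `u ≈ v` then `u` and `v` are the same word. -/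
def IsIsoterm (S : Type*) [Semigroup S] (u : FreeSemigroup ℕ) : Prop :=
  ∀ v : FreeSemigroup ℕ, Satisfies S u v → u = v

/-- The set of all isoterms for `S`, as a set of words. The empty word, which takes part in no
semigroup identity, is included; this does not affect `ReesMonoid (iso S)` as soon as `S` has
a nonempty isoterm, since the empty word is a subword of every word. -/
def iso (S : Type*) [Semigroup S] : Set (FreeMonoid ℕ) :=
  {w | ∀ u : FreeSemigroup ℕ, FreeSemigroup.toFreeMonoid u = w → IsIsoterm S u}

/-! ### Lee semigroups and Lee monoids -/

/-- The generators `a` and `b`. -/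
inductive Gen
  | a
  | b

/-- The alternating word `xyxy⋯` of length `n + 1`. -/
def alternating (x y : Gen) : ℕ → FreeSemigroup Gen
  | 0 => FreeSemigroup.of x
  | n + 1 => FreeSemigroup.of x * alternating y x n

/-- The defining relations `aa = a`, `bb = b`, `ababab⋯ = 0` (length `ℓ`, where `ℓ ≥ 1`) on the
free semigroup with zero over `{a, b}`. -/
inductive LeeRel (ℓ : ℕ) : WithZero (FreeSemigroup Gen) → WithZero (FreeSemigroup Gen) → Prop
  | aa : LeeRel ℓ ((FreeSemigroup.of Gen.a * FreeSemigroup.of Gen.a : FreeSemigroup Gen))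
      (FreeSemigroup.of Gen.a)
  | bb : LeeRel ℓ ((FreeSemigroup.of Gen.b * FreeSemigroup.of Gen.b : FreeSemigroup Gen))
      (FreeSemigroup.of Gen.b)
  | zero : LeeRel ℓ (alternating Gen.a Gen.b (ℓ - 1)) 0

/-- The Lee semigroup `L_ℓ = ⟨a, b ∣ aa = a, bb = b, ababab⋯ = 0⟩`, a semigroup with zero. -/
abbrev LeeSemigroup (ℓ : ℕ) : Type := (conGen (LeeRel ℓ)).Quotient

/-- The Lee monoid `L_ℓ¹`: the Lee semigroup with an identity element adjoined. -/
abbrev LeeMonoid (ℓ : ℕ) : Type := WithOne (LeeSemigroup ℓ)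

/-- The variable `a` as a one-letter word. -/
def wa : FreeMonoid ℕ := FreeMonoid.of 0

/-- The variable `b` as a one-letter word. -/
def wb : FreeMonoid ℕ := FreeMonoid.of 1

end Lee

/-! Let `k` be 1 or 2 and `ℓ = 2k + 1`. Call a letter of a word low if it occurs at most `k` times,
and high otherwise. `LowEquiv k` compares the contents of two words and the words formed by their
low letters.

Rees quotients: if every letter occurs at most `k` times in each word of `W`, a high letter with
nonempty value makes both sides of a `LowEquiv k` identity zero, so the identity holds in `S¹(W)`.
If moreover `W` captures all binary words of multiplicity at most `k`, there are no other
identities, because a word is determined by its restrictions to pairs of letters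
(`satisfiesList_rees_iff`). This covers the two listed sets and `boundedWords k`. The theory is
finitely based: short identities collect a high letter into a central power that absorbs its further
occurrences (`LowEquiv.deducibleList`).

Isoterms: `L_ℓ¹` acts on states that record progress through `abab⋯`, and an element is zero once it
carries state 0 to `ℓ`. An element other than `1`, `a`, `b` occurring `k + 1` times forces a product
to vanish, while `1`, `a`, `b` are idempotent; hence a high letter can be doubled. Words without
high letters are separated by the action, so `iso` is `boundedWords k` (`iso_lee`).

No finite basis: `wordU` and `wordV` contain two long chains of letters, cut into gaps by separators
and written in opposite orders. They form an identity because the two chains commute whenever their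
values do not kill both sides. Identities of `L_ℓ¹` preserve short alternating patterns, so each
word equal to `wordU` inherits the rigid gap structure `GapSystem`. There, all pairs of letters from
different chains that are consistently ordered in every gap have the same orientation (`not_both`).
One deduction step by an identity short relative to the chains leaves at least four letters of each
chain fixed relative to one another, and some pair of them is consistently ordered (`exists_same`).
So the orientation is an invariant (`FirstChainFirst.step`), but `wordU` and `wordV` have opposite
ones. -/

namespace Lee

/-! ### Words as lists -/

/-- The list of letters of a nonempty word. -/
def letters {α : Type*} (u : FreeSemigroup α) : List α := u.head :: u.tail

theorem letters_mul {α : Type*} (u v : FreeSemigroup α) :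
    letters (u * v) = letters u ++ letters v := rfl

theorem letters_of {α : Type*} (x : α) : letters (FreeSemigroup.of x) = [x] := rfl

theorem letters_ne_nil {α : Type*} (u : FreeSemigroup α) : letters u ≠ [] :=
  List.cons_ne_nil _ _

theorem letters_injective {α : Type*} : Function.Injective (letters (α := α)) := by
  rintro ⟨a, l⟩ ⟨b, m⟩ h
  simp only [letters, List.cons.injEq] at h
  exact FreeSemigroup.ext h.1 h.2

theorem exists_letters_eq {α : Type*} {l : List α} (h : l ≠ []) :
    ∃ u : FreeSemigroup α, letters u = l := by
  cases l with
  | nil => exact absurd rfl h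
  | cons a l => exact ⟨⟨a, l⟩, rfl⟩

theorem toFreeMonoid_eq_ofList {α : Type*} (u : FreeSemigroup α) :
    FreeSemigroup.toFreeMonoid u = FreeMonoid.ofList (letters u) := by
  obtain ⟨a, l⟩ := u
  exact FreeSemigroup.toFreeMonoid_mk_eq_cons a l

theorem lift_eq_prod {α M : Type*} [Monoid M] (θ : α → M) (u : FreeSemigroup α) :
    FreeSemigroup.lift θ u = ((letters u).map θ).prod := by
  induction u using FreeSemigroup.recOnMul with
  | ih1 x => simp [letters_of]
  | ih2 x y hx hy => simp [letters_mul, hx, hy]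

theorem letters_lift {α β : Type*} (θ : α → FreeSemigroup β) (u : FreeSemigroup α) :
    letters (FreeSemigroup.lift θ u) = (letters u).flatMap fun x => letters (θ x) := by
  induction u using FreeSemigroup.recOnMul with
  | ih1 x => simp [letters_of]
  | ih2 x y hx hy => simp [letters_mul, letters_of, hy]

/-- The monoid `M` satisfies the identity `s ≈ t` of possibly empty words. -/
def SatisfiesList (M : Type*) [Monoid M] (s t : List ℕ) : Prop :=
  ∀ θ : ℕ → M, (s.map θ).prod = (t.map θ).prod

theorem satisfies_iff {M : Type*} [Monoid M] {u v : FreeSemigroup ℕ} :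
    Satisfies M u v ↔ SatisfiesList M (letters u) (letters v) := by
  simp only [Satisfies, SatisfiesList, lift_eq_prod]

section SatisfiesList

variable {M : Type*} [Monoid M] {s t r : List ℕ}

theorem SatisfiesList.symm (h : SatisfiesList M s t) : SatisfiesList M t s :=
  fun θ => (h θ).symm

theorem SatisfiesList.trans (h : SatisfiesList M s t) (h' : SatisfiesList M t r) :
    SatisfiesList M s r :=
  fun θ => (h θ).trans (h' θ)

theorem SatisfiesList.append (h : SatisfiesList M s t) (p q : List ℕ) :
    SatisfiesList M (p ++ s ++ q) (p ++ t ++ q) := fun θ => by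
  simp only [List.map_append, List.prod_append, h θ]

theorem prod_map_flatMap {α β : Type*} (φ : α → List β) (θ : β → M) (l : List α) :
    ((l.flatMap φ).map θ).prod = (l.map fun x => ((φ x).map θ).prod).prod := by
  induction l with
  | nil => rfl
  | cons a l ih => simp [ih]

theorem SatisfiesList.flatMap (h : SatisfiesList M s t) (φ : ℕ → List ℕ) :
    SatisfiesList M (s.flatMap φ) (t.flatMap φ) := fun θ => by
  rw [prod_map_flatMap, prod_map_flatMap, h]

end SatisfiesList

/-! ### Letters of low multiplicity -/

/-- The word obtained from `l` by deleting all letters that occur more than `k` times. -/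
def low (k : ℕ) (l : List ℕ) : List ℕ := l.filter fun x => l.count x ≤ k

/-- `s` and `t` have the same content, and deleting the letters that occur more than `k` times
yields the same word. -/
def LowEquiv (k : ℕ) (s t : List ℕ) : Prop := (∀ x, x ∈ s ↔ x ∈ t) ∧ low k s = low k t

theorem mem_low {k : ℕ} {l : List ℕ} {x : ℕ} : x ∈ low k l ↔ x ∈ l ∧ l.count x ≤ k := by
  simp [low]

theorem LowEquiv.symm {k : ℕ} {s t : List ℕ} (h : LowEquiv k s t) : LowEquiv k t s :=
  ⟨fun x => (h.1 x).symm, h.2.symm⟩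

theorem LowEquiv.count_le {k : ℕ} {s t : List ℕ} (h : LowEquiv k s t) {x : ℕ}
    (hx : s.count x ≤ k) : t.count x ≤ k := by
  by_cases hs : x ∈ s
  · have : x ∈ low k t := h.2 ▸ mem_low.2 ⟨hs, hx⟩
    exact (mem_low.1 this).2
  · rw [h.1] at hs
    simp [List.count_eq_zero_of_not_mem hs]

theorem LowEquiv.count_le_iff {k : ℕ} {s t : List ℕ} (h : LowEquiv k s t) (x : ℕ) :
    s.count x ≤ k ↔ t.count x ≤ k :=
  ⟨h.count_le, h.symm.count_le⟩

theorem low_eq_self {k : ℕ} {l : List ℕ} (h : ∀ x, l.count x ≤ k) : low k l = l := by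
  simp [low, h]

theorem LowEquiv.eq {k : ℕ} {s t : List ℕ} (h : LowEquiv k s t) (hs : ∀ x, s.count x ≤ k) :
    s = t := by
  rw [← low_eq_self hs, h.2, low_eq_self fun x => h.count_le (hs x)]

/-- A list is determined by its restrictions to two letters. -/
theorem eq_of_filter_pair_eq {s t : List ℕ}
    (h : ∀ x y, s.filter (fun z => z = x ∨ z = y) = t.filter (fun z => z = x ∨ z = y)) :
    s = t := by
  induction s generalizing t with
  | nil =>
    cases t with
    | nil => rfl
    | cons b t => simpa using h b b
  | cons a s ih =>
    cases t with
    | nil => simpa using h a a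
    | cons b t =>
      have hab : a = b := by
        have := h a b
        simp only [List.filter_cons] at this
        simp only [true_or, or_true, decide_true, if_true, List.cons.injEq] at this
        exact this.1
      subst hab
      congr 1
      refine ih fun x y => ?_
      have := h x y
      simp only [List.filter_cons] at this
      split_ifs at this
      · exact (List.cons.inj this).2
      · exact this

/-- Identities of `M` preserve the restrictions to two letters occurring at most `k` times. -/
def Discriminates (k : ℕ) (M : Type*) [Monoid M] : Prop :=
  ∀ s t, SatisfiesList M s t → ∀ x y, s.count x ≤ k → s.count y ≤ k →
    s.filter (fun z => z = x ∨ z = y) = t.filter (fun z => z = x ∨ z = y)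

theorem count_filter_pair (l : List ℕ) (x y : ℕ) :
    (l.filter (fun z => z = x ∨ z = y)).count x = l.count x := by
  rw [List.count_filter]; simp

theorem Discriminates.count_eq {k : ℕ} {M : Type*} [Monoid M] (hM : Discriminates k M)
    {s t : List ℕ} (h : SatisfiesList M s t) {x : ℕ} (hx : s.count x ≤ k) :
    s.count x = t.count x := by
  rw [← count_filter_pair s x x, hM s t h x x hx hx, count_filter_pair]

/-- An absent letter has multiplicity `0 ≤ k`, which gives equality of contents; the low words agree
because all their restrictions to two letters do. -/
theorem Discriminates.lowEquiv {k : ℕ} {M : Type*} [Monoid M] (hM : Discriminates k M)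
    {s t : List ℕ} (h : SatisfiesList M s t) : LowEquiv k s t := by
  have key : ∀ {s t : List ℕ}, SatisfiesList M s t → ∀ x, x ∈ t → x ∈ s := by
    intro s t h x hx
    by_contra hs
    have h0 := List.count_eq_zero_of_not_mem hs
    have := hM.count_eq h (x := x) (by omega)
    rw [h0] at this
    exact List.count_eq_zero.1 this.symm hx
  have hc : ∀ x, s.count x ≤ k ↔ t.count x ≤ k := fun x =>
    ⟨fun hx => hM.count_eq h hx ▸ hx, fun hx => hM.count_eq h.symm hx ▸ hx⟩
  refine ⟨fun x => ⟨key h.symm x, key h x⟩, eq_of_filter_pair_eq fun x y => ?_⟩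
  have comm : ∀ (l : List ℕ) (p : ℕ → Bool), (low k l).filter p =
      (l.filter p).filter (fun z => l.count z ≤ k) := fun l p => by
    rw [low, List.filter_filter, List.filter_filter]
    simp only [Bool.and_comm]
  have main : ∀ x y, s.count x ≤ k → s.count y ≤ k →
      (low k s).filter (fun z => z = x ∨ z = y) = (low k t).filter (fun z => z = x ∨ z = y) := by
    intro x y hx hy
    rw [comm, comm, hM s t h x y hx hy]
    simp only [hc]
  -- A high letter `y` is missing from the low word, so the pair `x, y` may be replaced by `x, x`.
  have drop : ∀ x y, ¬ s.count y ≤ k → ∀ l, (∀ z, s.count z ≤ k ↔ l.count z ≤ k) →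
      (low k l).filter (fun z => z = x ∨ z = y) = (low k l).filter (fun z => z = x ∨ z = x) := by
    intro x y hy l hl
    refine List.filter_congr fun z hz => ?_
    have : z ≠ y := by
      rintro rfl
      exact hy ((hl z).2 (mem_low.1 hz).2)
    simp [this]
  have swap : ∀ (x y : ℕ) (l : List ℕ), l.filter (fun z => z = x ∨ z = y) =
      l.filter (fun z => z = y ∨ z = x) := fun x y l => by simp only [or_comm]
  by_cases hx : s.count x ≤ k <;> by_cases hy : s.count y ≤ k
  · exact main x y hx hy
  · rw [drop x y hy s (fun _ => Iff.rfl), drop x y hy t hc, main x x hx hx]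
  · rw [swap, swap x y, drop y x hx s (fun _ => Iff.rfl), drop y x hx t hc, main y y hy hy]
  · have nil : ∀ l, (∀ z, s.count z ≤ k ↔ l.count z ≤ k) →
        (low k l).filter (fun z => z = x ∨ z = y) = [] := by
      intro l hl
      refine List.filter_eq_nil_iff.2 fun z hz => ?_
      have := (hl z).2 (mem_low.1 hz).2
      simp only [decide_eq_true_eq]
      rintro (rfl | rfl) <;> contradiction
    rw [nil s fun _ => Iff.rfl, nil t hc]

/-! ### Identities of the monoids `S¹(W)` -/

theorem count_le_count_flatMap {φ : ℕ → List ℕ} {x z : ℕ} (h : z ∈ φ x) (s : List ℕ) :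
    s.count x ≤ (s.flatMap φ).count z := by
  induction s with
  | nil => simp
  | cons a s ih =>
    rw [List.flatMap_cons, List.count_append, List.count_cons]
    split_ifs with hax
    · have : a = x := by simpa using hax
      have := List.count_pos_iff.2 (this ▸ h)
      omega
    · omega

theorem flatMap_filter_of_eq_nil {φ : ℕ → List ℕ} {p : ℕ → Bool} {s : List ℕ}
    (h : ∀ x ∈ s, p x = false → φ x = []) : (s.filter p).flatMap φ = s.flatMap φ := by
  induction s with
  | nil => rfl
  | cons a s ih =>
    have ih := ih fun x hx => h x (List.mem_cons_of_mem _ hx)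
    cases hp : p a
    · simp [hp, ih, h a (by simp) hp]
    · simp [hp, ih]

theorem count_le_of_isSubwordOf {k : ℕ} {W : Set (FreeMonoid ℕ)}
    (hW : ∀ w ∈ W, ∀ x, w.toList.count x ≤ k) {u : FreeMonoid ℕ} (hu : IsSubwordOf W u) (x : ℕ) :
    u.toList.count x ≤ k := by
  obtain ⟨w, hw, p, q, rfl⟩ := hu
  have := hW _ hw x
  simp only [FreeMonoid.toList_mul, List.count_append] at this
  omega

theorem prod_map_mk (W : Set (FreeMonoid ℕ)) (θ : ℕ → FreeMonoid ℕ) (s : List ℕ) :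
    (s.map fun x => ((θ x : FreeMonoid ℕ) : ReesMonoid W)).prod =
      ((FreeMonoid.ofList (s.flatMap fun x => (θ x).toList) : FreeMonoid ℕ) : ReesMonoid W) := by
  induction s with
  | nil => rfl
  | cons a s ih =>
    rw [List.map_cons, List.prod_cons, ih, List.flatMap_cons, FreeMonoid.ofList_append,
      FreeMonoid.ofList_toList, Con.coe_mul]

/-- If a high letter has a nonempty value, some variable occurs more than `k` times in both values,
and both are zero. Otherwise the high letters vanish and the values depend on the low words only. -/
theorem LowEquiv.satisfiesList_rees {k : ℕ} {W : Set (FreeMonoid ℕ)}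
    (hW : ∀ w ∈ W, ∀ x, w.toList.count x ≤ k) {s t : List ℕ} (h : LowEquiv k s t) :
    SatisfiesList (ReesMonoid W) s t := by
  intro θ
  choose θ' hθ using fun x => Quotient.exists_rep (θ x)
  obtain rfl : (fun x => ((θ' x : FreeMonoid ℕ) : ReesMonoid W)) = θ := funext hθ
  rw [prod_map_mk, prod_map_mk, Con.eq]
  by_cases hx : ∃ x ∈ s, ¬ s.count x ≤ k ∧ (θ' x).toList ≠ []
  · obtain ⟨x, -, hk, hne⟩ := hx
    obtain ⟨z, hz⟩ := List.exists_mem_of_ne_nil _ hne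
    have key : ∀ l : List ℕ, ¬ l.count x ≤ k →
        ¬ IsSubwordOf W (FreeMonoid.ofList (l.flatMap fun x => (θ' x).toList)) := by
      intro l hl hsub
      have h1 := count_le_of_isSubwordOf hW hsub z
      have h2 := count_le_count_flatMap (φ := fun x => (θ' x).toList) hz l
      rw [FreeMonoid.toList_ofList] at h1
      omega
    exact Or.inr ⟨key s hk, key t ((h.count_le_iff x).not.1 hk)⟩
  · push Not at hx
    left
    have hs := flatMap_filter_of_eq_nil (φ := fun x => (θ' x).toList)
      (p := fun x => s.count x ≤ k) (s := s) fun x hxs hp => hx x hxs (by simpa using hp)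
    have ht := flatMap_filter_of_eq_nil (φ := fun x => (θ' x).toList)
      (p := fun x => t.count x ≤ k) (s := t) fun x hxt hp =>
        hx x ((h.1 x).2 hxt) (by have := (h.count_le_iff x).not; simp_all)
    rw [← hs, ← ht]
    exact congrArg (fun l => FreeMonoid.ofList (l.flatMap fun x => (θ' x).toList)) h.2

theorem eq_of_map_eq {α β : Type*} {f : α → β} {l m : List α} (h : l.map f = m.map f)
    (inj : ∀ a ∈ l, ∀ b ∈ m, f a = f b → a = b) : l = m := by
  induction l generalizing m with
  | nil => simpa using h.symm
  | cons a l ih =>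
    cases m with
    | nil => simp at h
    | cons b m =>
      simp only [List.map_cons, List.cons.injEq] at h
      rw [inj a (by simp) b (by simp) h.1,
        ih h.2 fun a ha b hb => inj a (by simp [ha]) b (by simp [hb])]

/-- The restriction of `l` to the letters `x` and `y`, renamed to `0` and `1`. -/
def pairWord (x y : ℕ) (l : List ℕ) : List ℕ :=
  (l.filter fun z => z = x ∨ z = y).map fun z => if z = x then 0 else 1

theorem lt_two_of_mem_pairWord {x y z : ℕ} {l : List ℕ} (h : z ∈ pairWord x y l) : z < 2 := by
  obtain ⟨w, -, rfl⟩ := List.mem_map.1 h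
  split_ifs <;> omega

theorem count_zero_pairWord (x y : ℕ) (l : List ℕ) : (pairWord x y l).count 0 = l.count x := by
  induction l with
  | nil => rfl
  | cons a l ih =>
    unfold pairWord at ih ⊢
    rcases eq_or_ne a x with rfl | hx
    · simpa using ih
    · rcases eq_or_ne a y with rfl | hy
      · simpa [hx] using ih
      · simpa [hx, hy] using ih

theorem count_one_pairWord {x y : ℕ} (hxy : x ≠ y) (l : List ℕ) :
    (pairWord x y l).count 1 = l.count y := by
  induction l with
  | nil => rfl
  | cons a l ih =>
    unfold pairWord at ih ⊢
    rcases eq_or_ne a x with rfl | hx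
    · simpa [hxy] using ih
    · rcases eq_or_ne a y with rfl | hy
      · simpa [hx] using ih
      · simpa [hx, hy] using ih

theorem count_pairWord_le {k x y : ℕ} {l : List ℕ} (hx : l.count x ≤ k) (hy : l.count y ≤ k)
    (z : ℕ) : (pairWord x y l).count z ≤ k := by
  by_cases hz : z ∈ pairWord x y l
  · have := lt_two_of_mem_pairWord hz
    interval_cases z
    · rwa [count_zero_pairWord]
    · by_cases hxy : x = y
      · subst hxy
        obtain ⟨w, hw, hw'⟩ := List.mem_map.1 hz
        have : w = x := by simpa using (List.mem_filter.1 hw).2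
        simp [this] at hw'
      · rwa [count_one_pairWord hxy]
  · simp [List.count_eq_zero_of_not_mem hz]

theorem filter_eq_of_pairWord_eq {x y : ℕ} {s t : List ℕ} (h : pairWord x y s = pairWord x y t) :
    s.filter (fun z => z = x ∨ z = y) = t.filter (fun z => z = x ∨ z = y) := by
  refine eq_of_map_eq h fun a ha b hb hab => ?_
  have ha : a = x ∨ a = y := by simpa using (List.mem_filter.1 ha).2
  have hb : b = x ∨ b = y := by simpa using (List.mem_filter.1 hb).2
  split_ifs at hab <;> simp_all

/-- Up to exchanging the letters, every word over `{0, 1}` in which both letters occur at most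
`k` times is a subword of a word in `W`. -/
def PairComplete (k : ℕ) (W : Set (FreeMonoid ℕ)) : Prop :=
  ∀ r : List ℕ, (∀ z ∈ r, z < 2) → (∀ z, r.count z ≤ k) →
    IsSubwordOf W (FreeMonoid.ofList r) ∨ IsSubwordOf W (FreeMonoid.ofList (r.map (1 - ·)))

/-- Substitute `1` for the letters outside `p` and the variable `σ x` for the others; by `hW` the
left-hand value is nonzero, hence known as a word. -/
theorem map_filter_eq_of_satisfiesList_rees {W : Set (FreeMonoid ℕ)} {s t : List ℕ}
    (h : SatisfiesList (ReesMonoid W) s t) (p : ℕ → Bool) (σ : ℕ → ℕ)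
    (hW : IsSubwordOf W (FreeMonoid.ofList ((s.filter p).map σ))) :
    (s.filter p).map σ = (t.filter p).map σ := by
  have key : ∀ l : List ℕ, (l.flatMap fun x =>
      (if p x then FreeMonoid.of (σ x) else 1 : FreeMonoid ℕ).toList) = (l.filter p).map σ := by
    intro l
    induction l with
    | nil => rfl
    | cons a l ih => cases hp : p a <;> simp [hp, ih]
  have := h fun x => ((if p x then FreeMonoid.of (σ x) else 1 : FreeMonoid ℕ) : ReesMonoid W)
  rw [prod_map_mk, prod_map_mk, Con.eq, key, key] at this
  rcases this with h | h
  · exact FreeMonoid.ofList.injective h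
  · exact absurd hW h.1

theorem PairComplete.discriminates {k : ℕ} {W : Set (FreeMonoid ℕ)} (hW : PairComplete k W) :
    Discriminates k (ReesMonoid W) := by
  intro s t h x y hx hy
  rcases hW (pairWord x y s) (fun z hz => lt_two_of_mem_pairWord hz)
    (count_pairWord_le hx hy) with hsub | hsub
  · exact filter_eq_of_pairWord_eq (map_filter_eq_of_satisfiesList_rees h _ _ hsub)
  · rw [pairWord, List.map_map] at hsub
    have := map_filter_eq_of_satisfiesList_rees h _ _ hsub
    refine filter_eq_of_pairWord_eq (eq_of_map_eq (f := (1 - ·)) ?_ ?_)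
    · rw [pairWord, pairWord, List.map_map, List.map_map, this]
    · intro a ha b hb hab
      have := lt_two_of_mem_pairWord ha
      have := lt_two_of_mem_pairWord hb
      omega

theorem satisfiesList_rees_iff {k : ℕ} {W : Set (FreeMonoid ℕ)}
    (hW : ∀ w ∈ W, ∀ x, w.toList.count x ≤ k) (hW' : PairComplete k W) {s t : List ℕ} :
    SatisfiesList (ReesMonoid W) s t ↔ LowEquiv k s t :=
  ⟨hW'.discriminates.lowEquiv, LowEquiv.satisfiesList_rees hW⟩

/-! ### The two listed sets of words, by finite enumeration -/

/-- All words of length at most `n` over `{0, 1}`. -/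
def binaryWords : ℕ → List (List ℕ)
  | 0 => [[]]
  | n + 1 => [] :: (binaryWords n).flatMap fun l => [0 :: l, 1 :: l]

theorem mem_binaryWords {r : List ℕ} (hr : ∀ z ∈ r, z < 2) {n : ℕ} (hn : r.length ≤ n) :
    r ∈ binaryWords n := by
  induction n generalizing r with
  | zero => simp [binaryWords, List.length_eq_zero_iff.1 (Nat.le_zero.1 hn)]
  | succ n ih =>
    cases r with
    | nil => simp [binaryWords]
    | cons a r =>
      have ha := hr a (by simp)
      have := ih (fun z hz => hr z (List.mem_cons_of_mem _ hz)) (by simpa using hn)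
      simp only [binaryWords, List.mem_cons, List.mem_flatMap]
      refine Or.inr ⟨r, this, ?_⟩
      interval_cases a <;> simp

theorem length_eq_count_add_count {r : List ℕ} (hr : ∀ z ∈ r, z < 2) :
    r.length = r.count 0 + r.count 1 := by
  induction r with
  | nil => rfl
  | cons a r ih =>
    have ha := hr a (by simp)
    have := ih fun z hz => hr z (by simp [hz])
    interval_cases a <;> simp <;> omega

theorem isSubwordOf_of_isInfix {W : Set (FreeMonoid ℕ)} {r w : List ℕ}
    (hw : FreeMonoid.ofList w ∈ W) (h : r <:+: w) : IsSubwordOf W (FreeMonoid.ofList r) := by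
  obtain ⟨p, q, rfl⟩ := h
  exact ⟨_, hw, FreeMonoid.ofList p, FreeMonoid.ofList q, by simp only [FreeMonoid.ofList_append]⟩

/-- Binary words with both multiplicities at most `k` have length at most `2k`, so completeness is a
finite check. -/
theorem pairComplete_of_list {k : ℕ} {W : Set (FreeMonoid ℕ)} (L : List (List ℕ))
    (hL : ∀ w ∈ L, FreeMonoid.ofList w ∈ W)
    (h : ∀ r ∈ binaryWords (k + k), r.count 0 ≤ k → r.count 1 ≤ k →
      ∃ w ∈ L, r <:+: w ∨ r.map (1 - ·) <:+: w) : PairComplete k W := by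
  intro r hr hc
  have hlen := length_eq_count_add_count hr
  obtain ⟨w, hw, hrw⟩ := h r (mem_binaryWords hr (by have := hc 0; have := hc 1; omega))
    (hc 0) (hc 1)
  exact hrw.imp (isSubwordOf_of_isInfix (hL w hw)) (isSubwordOf_of_isInfix (hL w hw))

theorem pairComplete_one : PairComplete 1 {wa * wb} :=
  pairComplete_of_list [[0, 1]] (by simp; rfl) (by decide)

theorem pairComplete_two :
    PairComplete 2 {wa * wb * wa * wb, wa ^ 2 * wb ^ 2, wa * wb ^ 2 * wa} :=
  pairComplete_of_list [[0, 1, 0, 1], [0, 0, 1, 1], [0, 1, 1, 0]]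
    (by
      intro w hw
      simp only [List.mem_cons, List.not_mem_nil, or_false] at hw
      rcases hw with rfl | rfl | rfl
      exacts [Or.inl rfl, Or.inr (Or.inl rfl), Or.inr (Or.inr rfl)])
    (by decide)

theorem count_le_of_mem_one {w : FreeMonoid ℕ} (hw : w ∈ ({wa * wb} : Set (FreeMonoid ℕ)))
    (x : ℕ) : w.toList.count x ≤ 1 := by
  obtain rfl := hw
  change List.count x [0, 1] ≤ 1
  simp only [List.count_cons, List.count_nil, beq_iff_eq]
  split_ifs <;> omega

theorem count_le_of_mem_two {w : FreeMonoid ℕ}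
    (hw : w ∈ ({wa * wb * wa * wb, wa ^ 2 * wb ^ 2, wa * wb ^ 2 * wa} : Set (FreeMonoid ℕ)))
    (x : ℕ) : w.toList.count x ≤ 2 := by
  rcases hw with rfl | rfl | rfl
  · change List.count x [0, 1, 0, 1] ≤ 2
    simp only [List.count_cons, List.count_nil, beq_iff_eq]
    split_ifs <;> omega
  · change List.count x [0, 0, 1, 1] ≤ 2
    simp only [List.count_cons, List.count_nil, beq_iff_eq]
    split_ifs <;> omega
  · change List.count x [0, 1, 1, 0] ≤ 2
    simp only [List.count_cons, List.count_nil, beq_iff_eq]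
    split_ifs <;> omega

/-- The words in which every letter occurs at most `k` times. -/
def boundedWords (k : ℕ) : Set (FreeMonoid ℕ) := {w | ∀ x, w.toList.count x ≤ k}

theorem pairComplete_boundedWords (k : ℕ) : PairComplete k (boundedWords k) := by
  intro r _ hr
  exact Or.inl ⟨FreeMonoid.ofList r, hr, 1, 1, by simp⟩

theorem satisfiesList_boundedWords_iff {k : ℕ} {s t : List ℕ} :
    SatisfiesList (ReesMonoid (boundedWords k)) s t ↔ LowEquiv k s t :=
  satisfiesList_rees_iff (fun _ hw => hw) (pairComplete_boundedWords k)

/-! ### Equational equivalence -/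

theorem var_eq_of_satisfies_iff {S T : Type} [Semigroup S] [Semigroup T]
    (h : ∀ u v, Satisfies S u v ↔ Satisfies T u v) : var S = var T := by
  have : ∀ K, IsVariety K → (Semigrp.of S ∈ K ↔ Semigrp.of T ∈ K) := by
    rintro K ⟨E, rfl⟩
    exact forall₂_congr fun p _ => h p.1 p.2
  unfold var
  congr 1
  ext K
  exact and_congr_right fun hK => this K hK

theorem equationallyEquivalent_of_lowEquiv {k : ℕ} {W W' : Set (FreeMonoid ℕ)}
    (hW : ∀ s t, SatisfiesList (ReesMonoid W) s t ↔ LowEquiv k s t)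
    (hW' : ∀ s t, SatisfiesList (ReesMonoid W') s t ↔ LowEquiv k s t) :
    EquationallyEquivalent W W' :=
  var_eq_of_satisfies_iff fun u v => by rw [satisfies_iff, satisfies_iff, hW, hW']

/-! ### A finite basis -/

/-- A filter keeps all occurrences of a letter or none, so surviving multiplicities do not change.
-/
theorem LowEquiv.filter {k : ℕ} {s t : List ℕ} (h : LowEquiv k s t) (p : ℕ → Bool) :
    LowEquiv k (s.filter p) (t.filter p) := by
  refine ⟨fun x => by simp [h.1 x], ?_⟩
  have key : ∀ l : List ℕ, low k (l.filter p) = (low k l).filter p := by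
    intro l
    rw [low, low, List.filter_comm p]
    refine List.filter_congr fun x hx => ?_
    rw [List.count_filter (List.mem_filter.1 hx).2]
  rw [key, key, h.2]

theorem lowEquiv_of_toFinset_eq {k : ℕ} {s t : List ℕ} (h : s.toFinset = t.toFinset)
    (h' : low k s = low k t) : LowEquiv k s t :=
  ⟨fun x => by rw [← List.mem_toFinset, h, List.mem_toFinset], h'⟩

/-- Deducibility of identities between possibly empty words. -/
def DeducibleList (E : Set (FreeSemigroup ℕ × FreeSemigroup ℕ)) (s t : List ℕ) : Prop :=
  (s = [] ∧ t = []) ∨ ∃ u v, letters u = s ∧ letters v = t ∧ Deducible E u v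

section DeducibleList

variable {E : Set (FreeSemigroup ℕ × FreeSemigroup ℕ)} {s t r s' t' : List ℕ}

theorem DeducibleList.refl (s : List ℕ) : DeducibleList E s s := by
  by_cases hs : s = []
  · exact Or.inl ⟨hs, hs⟩
  · obtain ⟨u, rfl⟩ := exists_letters_eq hs
    exact Or.inr ⟨u, u, rfl, rfl, (conGen _).refl u⟩

theorem DeducibleList.symm (h : DeducibleList E s t) : DeducibleList E t s := by
  rcases h with ⟨rfl, rfl⟩ | ⟨u, v, rfl, rfl, h⟩
  · exact refl _
  · exact Or.inr ⟨v, u, rfl, rfl, (conGen _).symm h⟩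

theorem DeducibleList.trans (h : DeducibleList E s t) (h' : DeducibleList E t r) :
    DeducibleList E s r := by
  rcases h with ⟨rfl, rfl⟩ | ⟨u, v, rfl, rfl, h⟩
  · exact h'
  · rcases h' with ⟨h1, -⟩ | ⟨v', w, h1, rfl, h'⟩
    · exact absurd h1 (letters_ne_nil v)
    · obtain rfl := letters_injective h1
      exact Or.inr ⟨u, w, rfl, rfl, (conGen _).trans h h'⟩

theorem DeducibleList.append (h : DeducibleList E s t) (h' : DeducibleList E s' t') :
    DeducibleList E (s ++ s') (t ++ t') := by
  rcases h with ⟨rfl, rfl⟩ | ⟨u, v, rfl, rfl, h⟩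
  · exact h'
  · rcases h' with ⟨rfl, rfl⟩ | ⟨u', v', rfl, rfl, h'⟩
    · rw [List.append_nil, List.append_nil]
      exact Or.inr ⟨u, v, rfl, rfl, h⟩
    · exact Or.inr ⟨u * u', v * v', rfl, rfl, (conGen _).mul h h'⟩

theorem DeducibleList.deducible {u v : FreeSemigroup ℕ}
    (h : DeducibleList E (letters u) (letters v)) : Deducible E u v := by
  rcases h with ⟨h, -⟩ | ⟨u', v', hu, hv, h⟩
  · exact absurd h (letters_ne_nil u)
  · rwa [← letters_injective hu, ← letters_injective hv]

end DeducibleList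

/-- Words of length at most five in three letters. -/
def IsShort (s : List ℕ) : Prop := s.length ≤ 5 ∧ ∀ x ∈ s, x < 3

instance : DecidablePred IsShort := fun s => by unfold IsShort; infer_instance

theorem finite_setOf_isShort : {u : FreeSemigroup ℕ | IsShort (letters u)}.Finite := by
  have h : {s : List ℕ | IsShort s}.Finite := by
    refine ((List.finite_length_le (Fin 3) 5).image (List.map Fin.val)).subset ?_
    rintro s ⟨h5, h3⟩
    refine ⟨s.attach.map fun x => ⟨x.1, h3 x.1 x.2⟩, by simpa using h5, ?_⟩
    simp [Function.comp_def]
  exact h.preimage letters_injective.injOn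

/-- The `LowEquiv k` identities between short words. -/
def shortBasis (k : ℕ) : Set (FreeSemigroup ℕ × FreeSemigroup ℕ) :=
  {p | IsShort (letters p.1) ∧ IsShort (letters p.2) ∧ LowEquiv k (letters p.1) (letters p.2)}

theorem finite_shortBasis (k : ℕ) : (shortBasis k).Finite :=
  (finite_setOf_isShort.prod finite_setOf_isShort).subset fun _ hp => ⟨hp.1, hp.2.1⟩

theorem IsShort.filter {s : List ℕ} (h : IsShort s) (p : ℕ → Bool) : IsShort (s.filter p) :=
  ⟨le_trans (List.length_filter_le _ _) h.1, fun x hx => h.2 x (List.mem_filter.1 hx).1⟩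

/-- Semigroup substitutions have no empty values. The letters with empty value are deleted
beforehand, and `shortBasis` is closed under such deletions. -/
theorem deducibleList_flatMap {k : ℕ} {s t : List ℕ} (hs : IsShort s) (ht : IsShort t)
    (h : LowEquiv k s t) (φ : ℕ → List ℕ) :
    DeducibleList (shortBasis k) (s.flatMap φ) (t.flatMap φ) := by
  let p : ℕ → Bool := fun x => φ x ≠ []
  have hnil : ∀ l : List ℕ, (l.filter p).flatMap φ = l.flatMap φ := fun l =>
    flatMap_filter_of_eq_nil fun x _ hx => by simpa [p] using hx
  have h' := h.filter p
  rw [← hnil s, ← hnil t]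
  by_cases hs0 : s.filter p = []
  · have ht0 : t.filter p = [] := List.eq_nil_iff_forall_not_mem.2 fun x hx => by
      simpa [hs0] using (h'.1 x).2 hx
    rw [hs0, ht0]
    exact DeducibleList.refl _
  have ht0 : t.filter p ≠ [] := fun ht0 => hs0 <| List.eq_nil_iff_forall_not_mem.2 fun x hx => by
    simpa [ht0] using (h'.1 x).1 hx
  obtain ⟨u, hu⟩ := exists_letters_eq hs0
  obtain ⟨v, hv⟩ := exists_letters_eq ht0
  choose! θ hθ using fun x (hx : φ x ≠ []) => exists_letters_eq hx
  have hmap : ∀ l : List ℕ, ((l.filter p).flatMap fun x => letters (θ x)) =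
      (l.filter p).flatMap φ := by
    intro l
    refine List.flatMap_congr fun x hx => hθ x ?_
    simpa [p] using (List.mem_filter.1 hx).2
  refine Or.inr ⟨FreeSemigroup.lift θ u, FreeSemigroup.lift θ v, ?_, ?_,
    ConGen.Rel.of _ _ ⟨(u, v), ⟨?_, ?_, ?_⟩, θ, rfl, rfl⟩⟩
  · rw [letters_lift, hu, hmap]
  · rw [letters_lift, hv, hmap]
  · exact hu ▸ hs.filter p
  · exact hv ▸ ht.filter p
  · simpa only [hu, hv] using h'

/-- The substitution `0 ↦ x`, `1 ↦ S`, `2 ↦ T`. -/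
def substThree (x : ℕ) (S T : List ℕ) : ℕ → List ℕ
  | 0 => [x]
  | 1 => S
  | _ => T

theorem deducibleList_power_comm {k : ℕ} (hk : k = 1 ∨ k = 2) (x : ℕ) (T : List ℕ) :
    DeducibleList (shortBasis k) (List.replicate (k + 1) x ++ T)
      (T ++ List.replicate (k + 1) x) := by
  rcases hk with rfl | rfl
  · simpa [substThree, List.replicate] using deducibleList_flatMap (k := 1) (s := [0, 0, 1])
      (t := [1, 0, 0]) (by decide) (by decide)
      (lowEquiv_of_toFinset_eq (by decide) (by decide)) (substThree x T [])
  · simpa [substThree, List.replicate] using deducibleList_flatMap (k := 2) (s := [0, 0, 0, 1])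
      (t := [1, 0, 0, 0]) (by decide) (by decide)
      (lowEquiv_of_toFinset_eq (by decide) (by decide)) (substThree x T [])

theorem deducibleList_power_succ {k : ℕ} (hk : k = 1 ∨ k = 2) (x : ℕ) :
    DeducibleList (shortBasis k) (List.replicate (k + 1) x ++ [x])
      (List.replicate (k + 1) x) := by
  rcases hk with rfl | rfl
  · simpa [substThree, List.replicate] using deducibleList_flatMap (k := 1) (s := [0, 0, 0])
      (t := [0, 0]) (by decide) (by decide)
      (lowEquiv_of_toFinset_eq (by decide) (by decide)) (substThree x [] [])
  · simpa [substThree, List.replicate] using deducibleList_flatMap (k := 2) (s := [0, 0, 0, 0])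
      (t := [0, 0, 0]) (by decide) (by decide)
      (lowEquiv_of_toFinset_eq (by decide) (by decide)) (substThree x [] [])

theorem deducibleList_absorb {k : ℕ} (hk : k = 1 ∨ k = 2) (x : ℕ) (T : List ℕ) :
    DeducibleList (shortBasis k) (List.replicate (k + 1) x ++ T)
      (List.replicate (k + 1) x ++ T.filter (· ≠ x)) := by
  induction T with
  | nil => exact DeducibleList.refl _
  | cons y T ih =>
    by_cases hy : y = x
    · subst hy
      have h1 := (deducibleList_power_succ hk y).append (DeducibleList.refl T)
      simpa using h1.trans ih
    · have h1 := (deducibleList_power_comm hk x [y]).append (DeducibleList.refl T)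
      have h2 := (DeducibleList.refl [y]).append ih
      have h3 := (deducibleList_power_comm hk x [y]).symm.append
        (DeducibleList.refl (T.filter (· ≠ x)))
      simp only [List.append_assoc] at h1 h2 h3
      simpa [hy] using (h1.trans h2).trans h3

theorem exists_eq_append_cons_of_lt_count {n x : ℕ} {l : List ℕ} (h : n < l.count x) :
    ∃ S T, l = S ++ x :: T ∧ x ∉ S ∧ n ≤ T.count x := by
  obtain ⟨S, T, rfl, hS⟩ := List.eq_append_cons_of_mem (List.count_pos_iff.1 (Nat.zero_lt_of_lt h))
  refine ⟨S, T, rfl, hS, ?_⟩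
  rw [List.count_append, List.count_cons_self, List.count_eq_zero_of_not_mem hS] at h
  omega

/-- The first `k + 1` occurrences of `x` are joined by `xyx ≈ xxy` or `xyxzx ≈ xxxyz`, the longest
identity needed; the power then moves to the front and absorbs the remaining `x`. -/
theorem deducibleList_gather {k : ℕ} (hk : k = 1 ∨ k = 2) {x : ℕ} {l : List ℕ}
    (h : k < l.count x) : DeducibleList (shortBasis k) l
      (List.replicate (k + 1) x ++ l.filter (· ≠ x)) := by
  obtain ⟨S, T, rfl, hS, hT⟩ := exists_eq_append_cons_of_lt_count h
  suffices ∃ T', DeducibleList (shortBasis k) (x :: T) (List.replicate (k + 1) x ++ T') ∧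
      T'.filter (· ≠ x) = T.filter (· ≠ x) by
    obtain ⟨T', h1, h2⟩ := this
    have h3 := (DeducibleList.refl S).append h1
    have h4 := (deducibleList_power_comm hk x S).symm.append (DeducibleList.refl T')
    simp only [List.append_assoc] at h3 h4
    have h5 := (h3.trans h4).trans (deducibleList_absorb hk x (S ++ T'))
    rw [List.filter_append, h2] at h5
    simpa using h5
  rcases hk with rfl | rfl
  · obtain ⟨S₁, T₁, rfl, hS₁, -⟩ := exists_eq_append_cons_of_lt_count hT
    refine ⟨S₁ ++ T₁, ?_, by simp⟩
    simpa [substThree, List.replicate] using (deducibleList_flatMap (k := 1) (s := [0, 1, 0])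
      (t := [0, 0, 1]) (by decide) (by decide)
      (lowEquiv_of_toFinset_eq (by decide) (by decide)) (substThree x S₁ [])).append
      (DeducibleList.refl T₁)
  · obtain ⟨S₁, T₁, rfl, hS₁, hT₁⟩ := exists_eq_append_cons_of_lt_count hT
    obtain ⟨S₂, T₂, rfl, hS₂, -⟩ := exists_eq_append_cons_of_lt_count hT₁
    refine ⟨S₁ ++ (S₂ ++ T₂), ?_, by simp⟩
    simpa [substThree, List.replicate] using (deducibleList_flatMap (k := 2)
      (s := [0, 1, 0, 2, 0]) (t := [0, 0, 0, 1, 2]) (by decide) (by decide)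
      (lowEquiv_of_toFinset_eq (by decide) (by decide)) (substThree x S₁ S₂)).append
      (DeducibleList.refl T₂)

theorem deducibleList_collect {k : ℕ} (hk : k = 1 ∨ k = 2) (H : List ℕ) (hH : H.Nodup)
    (l : List ℕ) (h : ∀ x ∈ H, k < l.count x) : DeducibleList (shortBasis k) l
      (H.flatMap (List.replicate (k + 1)) ++ l.filter (· ∉ H)) := by
  induction H generalizing l with
  | nil => simpa using DeducibleList.refl l
  | cons x H ih =>
    rw [List.nodup_cons] at hH
    have h1 := deducibleList_gather hk (h x (by simp))
    have h2 := ih hH.2 (l.filter (· ≠ x)) fun y hy => by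
      have hyx : y ≠ x := by rintro rfl; exact hH.1 hy
      rw [List.count_filter (by simpa using hyx)]
      exact h y (by simp [hy])
    have h3 := h1.trans ((DeducibleList.refl _).append h2)
    simpa [List.filter_filter, not_or, Bool.and_comm] using h3

/-- Both words reduce to one normal form: the powers of the high letters, in an order fixed by `s`,
followed by the common low word. -/
theorem LowEquiv.deducibleList {k : ℕ} (hk : k = 1 ∨ k = 2) {s t : List ℕ}
    (h : LowEquiv k s t) : DeducibleList (shortBasis k) s t := by
  let H := (s.filter fun x => k < s.count x).dedup
  have hH : ∀ x, x ∈ H ↔ x ∈ s ∧ k < s.count x := by simp [H]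
  have key : ∀ l, LowEquiv k s l → l.filter (· ∉ H) = low k l := by
    intro l hl
    refine List.filter_congr fun x hx => ?_
    have := hl.count_le_iff x
    simp only [hH, hl.1 x, hx, true_and, decide_eq_decide]
    omega
  have hs := deducibleList_collect hk H (List.nodup_dedup _) s fun x hx => ((hH x).1 hx).2
  have ht := deducibleList_collect hk H (List.nodup_dedup _) t fun x hx => by
    have := ((hH x).1 hx).2
    have := h.count_le_iff x
    omega
  rw [key s ⟨fun _ => Iff.rfl, rfl⟩] at hs
  rw [key t h, ← h.2] at ht
  exact hs.trans ht.symm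

theorem finitelyBased_of_lowEquiv {k : ℕ} (hk : k = 1 ∨ k = 2) {M : Type*} [Monoid M]
    (hM : ∀ s t, SatisfiesList M s t ↔ LowEquiv k s t) : FinitelyBased M :=
  ⟨shortBasis k, finite_shortBasis k, fun _ hp => satisfies_iff.2 ((hM _ _).2 hp.2.2),
    fun _ _ h => (((hM _ _).1 (satisfies_iff.1 h)).deducibleList hk).deducible⟩

/-! ### An action of the Lee monoid -/

/-- State `n < ℓ` expects the letter `a` if `n` is even and the letter `b` if `n` is odd; reading
the expected letter increases the state by one. -/
def step (ℓ : ℕ) : Gen → ℕ → ℕ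
  | .a, n => if n < ℓ ∧ n % 2 = 0 then n + 1 else n
  | .b, n => if n < ℓ ∧ n % 2 = 1 then n + 1 else n

/-- The state reached from `n` after reading a word. -/
def readWord (ℓ : ℕ) (n : ℕ) (w : List Gen) : ℕ := w.foldl (fun n g => step ℓ g n) n

/-- The action of the free semigroup with zero. -/
def actZero (ℓ : ℕ) : WithZero (FreeSemigroup Gen) → ℕ → ℕ
  -- All letters fix the states beyond `ℓ`, so the relation `abab⋯ = 0` forces zero to fix them too.
  | none, n => max n ℓ
  | some u, n => readWord ℓ n (letters u)

theorem le_step (ℓ : ℕ) (g : Gen) (n : ℕ) : n ≤ step ℓ g n := by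
  cases g <;> simp only [step] <;> split_ifs <;> omega

theorem step_mono (ℓ : ℕ) (g : Gen) {m n : ℕ} (h : m ≤ n) : step ℓ g m ≤ step ℓ g n := by
  cases g <;> simp only [step] <;> split_ifs <;> omega

theorem step_of_le {ℓ : ℕ} (g : Gen) {n : ℕ} (h : ℓ ≤ n) : step ℓ g n = n := by
  cases g <;> simp only [step] <;> split_ifs <;> omega

theorem step_le {ℓ : ℕ} (g : Gen) {n : ℕ} (h : n ≤ ℓ) : step ℓ g n ≤ ℓ := by
  cases g <;> simp only [step] <;> split_ifs <;> omega

theorem readWord_append (ℓ n : ℕ) (u v : List Gen) :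
    readWord ℓ n (u ++ v) = readWord ℓ (readWord ℓ n u) v := List.foldl_append

theorem readWord_of_le {ℓ : ℕ} (w : List Gen) {n : ℕ} (h : ℓ ≤ n) : readWord ℓ n w = n := by
  induction w with
  | nil => rfl
  | cons g w ih => rw [readWord, List.foldl_cons, step_of_le g h]; exact ih

theorem readWord_le {ℓ : ℕ} (w : List Gen) {n : ℕ} (h : n ≤ ℓ) : readWord ℓ n w ≤ ℓ := by
  induction w generalizing n with
  | nil => exact h
  | cons g w ih => exact ih (step_le g h)

theorem le_readWord (ℓ : ℕ) (w : List Gen) (n : ℕ) : n ≤ readWord ℓ n w := by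
  induction w generalizing n with
  | nil => exact le_rfl
  | cons g w ih => exact (le_step ℓ g n).trans (ih _)

theorem readWord_mono (ℓ : ℕ) (w : List Gen) {m n : ℕ} (h : m ≤ n) :
    readWord ℓ m w ≤ readWord ℓ n w := by
  induction w generalizing m n with
  | nil => exact h
  | cons g w ih => exact ih (step_mono ℓ g h)

theorem actZero_mul (ℓ : ℕ) (x y : WithZero (FreeSemigroup Gen)) (n : ℕ) :
    actZero ℓ (x * y) n = actZero ℓ y (actZero ℓ x n) := by
  rcases x with _ | u <;> rcases y with _ | v
  · change max n ℓ = max (max n ℓ) ℓ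
    omega
  · change max n ℓ = readWord ℓ (max n ℓ) (letters v)
    rw [readWord_of_le _ (le_max_right _ _)]
  · change max n ℓ = max (readWord ℓ n (letters u)) ℓ
    rcases le_total n ℓ with h | h
    · have := readWord_le (letters u) h
      omega
    · rw [readWord_of_le _ h]
  · exact readWord_append ℓ n (letters u) (letters v)

theorem readWord_alternating (ℓ m n : ℕ) :
    (m % 2 = 0 → readWord ℓ m (letters (alternating .a .b n)) = max m (min (m + n + 1) ℓ)) ∧
    (m % 2 = 1 → readWord ℓ m (letters (alternating .b .a n)) = max m (min (m + n + 1) ℓ)) := by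
  induction n generalizing m with
  | zero =>
    constructor <;> intro h <;>
      simp only [alternating, letters_of, readWord, List.foldl_cons, List.foldl_nil, step] <;>
      split_ifs <;> omega
  | succ n ih =>
    by_cases hm : m < ℓ
    · constructor <;> intro h
      · have := (ih (m + 1)).2 (by omega)
        rw [alternating, letters_mul, letters_of, readWord_append]
        have hs : readWord ℓ m [Gen.a] = m + 1 := by simp [readWord, step, hm, h]
        rw [hs, this]
        omega
      · have := (ih (m + 1)).1 (by omega)
        rw [alternating, letters_mul, letters_of, readWord_append]
        have hs : readWord ℓ m [Gen.b] = m + 1 := by simp [readWord, step, hm, h]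
        rw [hs, this]
        omega
    · constructor <;> intro _ <;> rw [readWord_of_le _ (by omega)] <;> omega

theorem step_step (ℓ : ℕ) (g : Gen) (n : ℕ) : step ℓ g (step ℓ g n) = step ℓ g n := by
  cases g <;> simp only [step] <;> split_ifs <;> omega

theorem actZero_eq_of_leeRel {ℓ : ℕ} (hℓ : 0 < ℓ) {x y : WithZero (FreeSemigroup Gen)}
    (h : LeeRel ℓ x y) : actZero ℓ x = actZero ℓ y := by
  funext n
  cases h with
  | aa => exact step_step ℓ .a n
  | bb => exact step_step ℓ .b n
  | zero =>
    change readWord ℓ n (letters (alternating .a .b (ℓ - 1))) = max n ℓ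
    rcases Nat.mod_two_eq_zero_or_one n with h | h
    · rw [(readWord_alternating ℓ n _).1 h]
      omega
    · by_cases hn : n < ℓ
      -- From an odd state the first `a` may be wasted, but monotonicity compares with the run from
      -- 0, which already reaches `ℓ`.
      · have h1 := readWord_mono ℓ (letters (alternating .a .b (ℓ - 1))) (Nat.zero_le n)
        rw [(readWord_alternating ℓ 0 _).1 rfl] at h1
        have h2 := readWord_le (letters (alternating .a .b (ℓ - 1))) hn.le
        omega
      · rw [readWord_of_le _ (by omega)]
        omega

theorem actZero_eq_of_conGen {ℓ : ℕ} (hℓ : 0 < ℓ) {x y : WithZero (FreeSemigroup Gen)}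
    (h : conGen (LeeRel ℓ) x y) : actZero ℓ x = actZero ℓ y := by
  let c : Con (WithZero (FreeSemigroup Gen)) :=
    { r := fun x y => actZero ℓ x = actZero ℓ y
      iseqv := ⟨fun _ => rfl, Eq.symm, Eq.trans⟩
      mul' := by
        intro x y x' y' h h'
        funext n
        rw [actZero_mul, actZero_mul, h, h'] }
  have : conGen (LeeRel ℓ) ≤ c := Con.conGen_le.2 fun _ _ h => actZero_eq_of_leeRel hℓ h
  exact this h

/-- The action of the Lee semigroup `L_ℓ` on states, for `ℓ = m + 1`. -/
def actSemigroup (m : ℕ) (x : LeeSemigroup (m + 1)) : ℕ → ℕ :=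
  Quotient.lift (actZero (m + 1)) (fun _ _ h => actZero_eq_of_conGen m.succ_pos h) x

/-- The action of the Lee monoid `L_ℓ¹` on states, for `ℓ = m + 1`. -/
def act (m : ℕ) : LeeMonoid (m + 1) → ℕ → ℕ
  | none => id
  | some x => actSemigroup m x

theorem act_mul (m : ℕ) (x y : LeeMonoid (m + 1)) (n : ℕ) :
    act m (x * y) n = act m y (act m x n) := by
  rcases x with _ | x <;> rcases y with _ | y
  · rfl
  · rfl
  · rfl
  · induction x using Con.induction_on with | H x =>
    induction y using Con.induction_on with | H y =>
    exact actZero_mul (m + 1) x y n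

/-! ### Normal forms in the Lee monoid -/

/-- The image of a generator in the Lee monoid. -/
def gen (ℓ : ℕ) (g : Gen) : LeeMonoid ℓ :=
  ((((FreeSemigroup.of g : FreeSemigroup Gen) : WithZero (FreeSemigroup Gen)) :
    LeeSemigroup ℓ) : LeeMonoid ℓ)

/-- The zero of the Lee monoid. -/
def zero (ℓ : ℕ) : LeeMonoid ℓ :=
  (((0 : WithZero (FreeSemigroup Gen)) : LeeSemigroup ℓ) : LeeMonoid ℓ)

/-- The element of the Lee monoid represented by a word. -/
def eval (ℓ : ℕ) (w : List Gen) : LeeMonoid ℓ := (w.map (gen ℓ)).prod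

theorem eval_append (ℓ : ℕ) (u v : List Gen) : eval ℓ (u ++ v) = eval ℓ u * eval ℓ v := by
  simp [eval]

theorem act_eval (m : ℕ) (w : List Gen) (n : ℕ) :
    act m (eval (m + 1) w) n = readWord (m + 1) n w := by
  induction w generalizing n with
  | nil => rfl
  | cons g w ih =>
    rw [eval, List.map_cons, List.prod_cons, act_mul]
    exact ih _

theorem eval_letters (ℓ : ℕ) (u : FreeSemigroup Gen) :
    eval ℓ (letters u) = (((u : WithZero (FreeSemigroup Gen)) : LeeSemigroup ℓ) : LeeMonoid ℓ) := by
  induction u using FreeSemigroup.recOnMul with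
  | ih1 x => simp [eval, letters_of, gen]
  | ih2 x y hx hy =>
    rw [letters_mul, eval_append, hy, hx]
    rfl

theorem eq_zero_or_exists_eval (ℓ : ℕ) (x : LeeMonoid ℓ) : x = zero ℓ ∨ ∃ w, x = eval ℓ w := by
  rcases x with _ | x
  · exact Or.inr ⟨[], rfl⟩
  · induction x using Con.induction_on with | H x =>
    rcases x with _ | u
    · exact Or.inl rfl
    · exact Or.inr ⟨letters u, (eval_letters ℓ u).symm⟩

theorem zero_mul (ℓ : ℕ) (x : LeeMonoid ℓ) : zero ℓ * x = zero ℓ := by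
  rcases x with _ | x
  · rfl
  · induction x using Con.induction_on with | H x =>
    exact congrArg (fun z : WithZero (FreeSemigroup Gen) => ((z : LeeSemigroup ℓ) : LeeMonoid ℓ))
      (MulZeroClass.zero_mul x)

theorem mul_zero (ℓ : ℕ) (x : LeeMonoid ℓ) : x * zero ℓ = zero ℓ := by
  rcases x with _ | x
  · rfl
  · induction x using Con.induction_on with | H x =>
    exact congrArg (fun z : WithZero (FreeSemigroup Gen) => ((z : LeeSemigroup ℓ) : LeeMonoid ℓ))
      (MulZeroClass.mul_zero x)

theorem gen_mul_gen (ℓ : ℕ) (g : Gen) : gen ℓ g * gen ℓ g = gen ℓ g := by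
  have : (conGen (LeeRel ℓ)) ((FreeSemigroup.of g * FreeSemigroup.of g : FreeSemigroup Gen) :
      WithZero (FreeSemigroup Gen)) ((FreeSemigroup.of g : FreeSemigroup Gen)) := by
    cases g
    · exact ConGen.Rel.of _ _ LeeRel.aa
    · exact ConGen.Rel.of _ _ LeeRel.bb
  exact congrArg _ ((Con.eq _).2 this)

/-- The generator expected in state `n`. -/
def expected (n : ℕ) : Gen := if n % 2 = 0 then .a else .b

/-- The product `abab⋯` of length `n`. -/
def altProd (ℓ : ℕ) : ℕ → LeeMonoid ℓ
  | 0 => 1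
  | n + 1 => altProd ℓ n * gen ℓ (expected n)

theorem eval_alternating (ℓ m n : ℕ) :
    altProd ℓ m * eval ℓ (letters (alternating (expected m) (expected (m + 1)) n)) =
      altProd ℓ (m + n + 1) := by
  induction n generalizing m with
  | zero => simp [alternating, letters_of, eval, altProd]
  | succ n ih =>
    have h2 : expected (m + 2) = expected m := by simp [expected]
    rw [alternating, letters_mul, eval_append, ← mul_assoc]
    have := ih (m + 1)
    rw [h2] at this
    rw [letters_of, eval, List.map_singleton, List.prod_singleton]
    change altProd ℓ (m + 1) * _ = _
    rw [this]
    congr 1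
    omega

theorem altProd_eq_zero {ℓ : ℕ} (hℓ : 0 < ℓ) : altProd ℓ ℓ = zero ℓ := by
  have h := eval_alternating ℓ 0 (ℓ - 1)
  rw [altProd, one_mul, eval_letters, show 0 + (ℓ - 1) + 1 = ℓ by omega] at h
  rw [← h]
  exact congrArg _ ((Con.eq _).2 (ConGen.Rel.of _ _ LeeRel.zero))

/-- The generator not expected is the last factor of the product and is absorbed by idempotency.
This needs a nonempty product, hence `n + 1`. -/
theorem altProd_mul_gen (ℓ n : ℕ) {g : Gen} (hg : g ≠ expected (n + 1)) :
    altProd ℓ (n + 1) * gen ℓ g = altProd ℓ (n + 1) := by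
  have : g = expected n := by
    have h : n % 2 = 0 ∨ n % 2 = 1 := by omega
    rcases h with h | h <;> cases g <;> simp_all [expected, Nat.add_mod]
  rw [altProd, this, mul_assoc, gen_mul_gen]

theorem step_expected {ℓ n : ℕ} (h : n < ℓ) : step ℓ (expected n) n = n + 1 := by
  unfold expected
  split_ifs with h0
  · simp [step, h, h0]
  · simp only [step]
    rw [if_pos]
    omega

theorem step_of_ne_expected {ℓ n : ℕ} {g : Gen} (h : g ≠ expected n) : step ℓ g n = n := by
  unfold expected at h
  split_ifs at h with h0
  · cases g <;> simp_all [step]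
  · cases g <;> simp_all [step]

/-- The normal form of a word in the Lee monoid. -/
theorem eval_eq_altProd {ℓ : ℕ} (hℓ : 0 < ℓ) (w : List Gen) :
    eval ℓ w = altProd ℓ (readWord ℓ 0 w) ∨
      eval ℓ w = gen ℓ .b * altProd ℓ (readWord ℓ 0 w) := by
  induction w using List.reverseRecOn with
  | nil => exact Or.inl rfl
  | append_singleton w g ih =>
    have hle := readWord_le (ℓ := ℓ) w (Nat.zero_le ℓ)
    rw [eval_append, readWord_append]
    generalize readWord ℓ 0 w = n at ih hle
    have hg : eval ℓ [g] = gen ℓ g := by simp [eval]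
    rw [hg]
    change _ = altProd ℓ (step ℓ g n) ∨ _ = gen ℓ .b * altProd ℓ (step ℓ g n)
    rcases hle.lt_or_eq with hn | rfl
    · by_cases he : g = expected n
      · rw [he, step_expected hn]
        exact ih.imp (fun h => by rw [h, altProd]) (fun h => by rw [h, altProd, mul_assoc])
      · rw [step_of_ne_expected he]
        cases n with
        | zero =>
          -- An unexpected letter in state 0 is `b`; it produces the left factor `b` of the second
          -- form.
          have : g = .b := by cases g <;> simp_all [expected]
          subst this
          right
          rcases ih with h | h <;> simp [h, altProd, gen_mul_gen]
        | succ n =>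
          exact ih.imp (fun h => by rw [h, altProd_mul_gen ℓ n he])
            (fun h => by rw [h, mul_assoc, altProd_mul_gen ℓ n he])
    · rw [step_of_le g le_rfl]
      rw [altProd_eq_zero hℓ, mul_zero, or_self] at ih ⊢
      rw [ih, zero_mul]

/-- The state reached from 0 determines the normal form up to a left factor `b`, and at the top
state both forms are zero. All later proofs that a product vanishes use this criterion. -/
theorem eq_zero_of_le_act {m : ℕ} {x : LeeMonoid (m + 1)} (h : m + 1 ≤ act m x 0) :
    x = zero (m + 1) := by
  rcases eq_zero_or_exists_eval _ x with rfl | ⟨w, rfl⟩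
  · rfl
  · rw [act_eval] at h
    have := readWord_le (ℓ := m + 1) w (Nat.zero_le _)
    have hr : readWord (m + 1) 0 w = m + 1 := le_antisymm this h
    have := eval_eq_altProd m.succ_pos w
    rwa [hr, altProd_eq_zero m.succ_pos, mul_zero, or_self] at this

theorem act_zero (m n : ℕ) : act m (zero (m + 1)) n = max n (m + 1) := rfl

/-! ### Monotonicity of the action and vanishing products -/

theorem le_act {m : ℕ} (x : LeeMonoid (m + 1)) (n : ℕ) : n ≤ act m x n := by
  rcases eq_zero_or_exists_eval _ x with rfl | ⟨w, rfl⟩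
  · exact le_max_left _ _
  · rw [act_eval]; exact le_readWord _ w n

theorem act_mono {m : ℕ} (x : LeeMonoid (m + 1)) {n n' : ℕ} (h : n ≤ n') :
    act m x n ≤ act m x n' := by
  rcases eq_zero_or_exists_eval _ x with rfl | ⟨w, rfl⟩
  · rw [act_zero, act_zero]; omega
  · rw [act_eval, act_eval]; exact readWord_mono _ w h

/-- Deleting factors from a product decreases its action. -/
theorem act_prod_le_of_sublist {m : ℕ} {l l' : List (LeeMonoid (m + 1))} (h : l.Sublist l')
    (n : ℕ) : act m l.prod n ≤ act m l'.prod n := by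
  induction h generalizing n with
  | slnil => exact le_rfl
  | cons x _ ih =>
    rw [List.prod_cons, act_mul]
    exact (ih n).trans (act_mono _ (le_act x n))
  | cons_cons x _ ih =>
    rw [List.prod_cons, List.prod_cons, act_mul, act_mul]
    exact ih _

theorem act_gen (m : ℕ) (g : Gen) (n : ℕ) : act m (gen (m + 1) g) n = step (m + 1) g n := rfl

/-- Every element of the Lee monoid other than `1`, `a` and `b` is divided, as a scattered
product, by `ab` or by `ba`. -/
theorem eq_or_le_act (m : ℕ) (x : LeeMonoid (m + 1)) :
    x = 1 ∨ (∃ g, x = gen (m + 1) g) ∨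
      (∀ n, n % 2 = 0 → min (n + 2) (m + 1) ≤ act m x n) ∨
      (∀ n, n % 2 = 1 → min (n + 2) (m + 1) ≤ act m x n) := by
  rcases eq_zero_or_exists_eval _ x with rfl | ⟨w, rfl⟩
  · right; right; left
    intro n _
    rw [act_zero]; omega
  · induction w with
    | nil => exact Or.inl rfl
    | cons g w ih =>
      have hcons : eval (m + 1) (g :: w) = gen (m + 1) g * eval (m + 1) w := by simp [eval]
      right
      rcases ih with h | ⟨g', h⟩ | h | h
      · left
        exact ⟨g, by rw [hcons, h, mul_one]⟩
      · rw [hcons, h]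
        by_cases hg : g = g'
        · left
          exact ⟨g, by rw [hg, gen_mul_gen]⟩
        · right
          cases g <;> cases g' <;> simp only [not_true_eq_false, reduceCtorEq,
            not_false_eq_true] at hg
          · left
            intro n hn
            rw [act_mul, act_gen, act_gen]
            simp only [step]
            split_ifs <;> omega
          · right
            intro n hn
            rw [act_mul, act_gen, act_gen]
            simp only [step]
            split_ifs <;> omega
      · right; left
        intro n hn
        rw [hcons, act_mul]
        exact (h n hn).trans (act_mono _ (le_act _ n))
      · right; right
        intro n hn
        rw [hcons, act_mul]
        exact (h n hn).trans (act_mono _ (le_act _ n))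

/-- A product with at least `k + 1` factors equal to `x` vanishes in `L¹_{2k+1}`, unless `x` is
`1`, `a` or `b`. -/
theorem prod_eq_zero_of_count {k : ℕ} {x : LeeMonoid (2 * k + 1)} (h1 : x ≠ 1)
    (hg : ∀ g, x ≠ gen (2 * k + 1) g) {l : List (LeeMonoid (2 * k + 1))}
    (hl : (List.replicate (k + 1) x).Sublist l) : l.prod = zero (2 * k + 1) := by
  refine eq_zero_of_le_act (le_trans ?_ (act_prod_le_of_sublist hl 0))
  rcases eq_or_le_act _ x with h | ⟨g, h⟩ | h | h
  · exact absurd h h1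
  · exact absurd h (hg g)
  -- From even states each `x` gains at least 2, so `k + 1` copies carry 0 to the top `2k + 1`. A
  -- larger gain, which may change the parity, is cut back to `n + 2` by monotonicity.
  · have key : ∀ j n, n % 2 = 0 →
        min (n + 2 * j) (2 * k + 1) ≤ act (2 * k) (List.replicate j x).prod n := by
      intro j
      induction j with
      | zero => exact fun n _ => min_le_left _ _
      | succ j ih =>
        intro n hn
        rw [List.replicate_succ, List.prod_cons, act_mul]
        have h' := h n hn
        by_cases hlt : n + 2 ≤ 2 * k + 1
        · have := act_mono (List.replicate j x).prod (n := n + 2) (n' := act (2 * k) x n) (by omega)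
          have := ih (n + 2) (by omega)
          omega
        · have := le_act (List.replicate j x).prod (act (2 * k) x n)
          omega
    have := key (k + 1) 0 rfl
    omega
  · have key : ∀ j n, n % 2 = 1 →
        min (n + 2 * j) (2 * k + 1) ≤ act (2 * k) (List.replicate j x).prod n := by
      intro j
      induction j with
      | zero => exact fun n _ => min_le_left _ _
      | succ j ih =>
        intro n hn
        rw [List.replicate_succ, List.prod_cons, act_mul]
        have h' := h n hn
        by_cases hlt : n + 2 ≤ 2 * k + 1
        · have := act_mono (List.replicate j x).prod (n := n + 2) (n' := act (2 * k) x n) (by omega)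
          have := ih (n + 2) (by omega)
          omega
        · have := le_act (List.replicate j x).prod (act (2 * k) x n)
          omega
    -- When the gain of 2 is from odd states, the first copy serves to leave state 0 (only `1` and
    -- `b` do not), and the `k` others gain `2k`.
    have h0 : 1 ≤ act (2 * k) x 0 := by
      rcases eq_zero_or_exists_eval _ x with rfl | ⟨w, rfl⟩
      · rw [act_zero]; omega
      · rw [act_eval]
        by_contra hc
        have hr : readWord (2 * k + 1) 0 w = 0 := by omega
        have hev := eval_eq_altProd (2 * k).succ_pos w
        rw [hr, altProd, mul_one] at hev
        exact hev.elim h1 (hg .b)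
    rw [List.replicate_succ, List.prod_cons, act_mul]
    have := act_mono (List.replicate k x).prod h0
    have := key k 1 rfl
    omega

/-! ### Identities of the Lee monoids -/

theorem act_prod_map_eval (m : ℕ) (φ : ℕ → List Gen) (s : List ℕ) (n : ℕ) :
    act m (s.map fun x => eval (m + 1) (φ x)).prod n = readWord (m + 1) n (s.flatMap φ) := by
  rw [← act_eval, eval, prod_map_flatMap]
  rfl

theorem SatisfiesList.readWord_eq {m : ℕ} {s t : List ℕ}
    (h : SatisfiesList (LeeMonoid (m + 1)) s t) (φ : ℕ → List Gen) (n : ℕ) :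
    readWord (m + 1) n (s.flatMap φ) = readWord (m + 1) n (t.flatMap φ) := by
  rw [← act_prod_map_eval, ← act_prod_map_eval, h]

/-- Every occurrence of `x` reads `ab` and gains two states. Starting from 0, the ceiling `2k + 1`
leaves multiplicities up to `k` visible. -/
theorem readWord_count (k x : ℕ) (s : List ℕ) {n : ℕ} (hn : n % 2 = 0) (hnk : n ≤ 2 * k) :
    readWord (2 * k + 1) n (s.flatMap fun z => if z = x then [.a, .b] else []) =
      min (n + 2 * s.count x) (2 * k + 1) := by
  induction s generalizing n with
  | nil => simp only [List.flatMap_nil, List.count_nil, readWord, List.foldl_nil]; omega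
  | cons a s ih =>
    rw [List.flatMap_cons, readWord_append, List.count_cons]
    by_cases ha : a = x
    · subst ha
      simp only [if_true, beq_self_eq_true]
      by_cases hlt : n + 2 ≤ 2 * k
      · have : readWord (2 * k + 1) n [.a, .b] = n + 2 := by
          simp only [readWord, List.foldl_cons, List.foldl_nil, step]
          split_ifs <;> omega
        rw [this, ih (by omega) hlt]
        omega
      · have : readWord (2 * k + 1) n [.a, .b] = 2 * k + 1 := by
          simp only [readWord, List.foldl_cons, List.foldl_nil, step]
          split_ifs <;> omega
        rw [this, readWord_of_le _ le_rfl]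
        omega
    · simp only [ha, if_false, beq_iff_eq]
      exact ih hn hnk

theorem SatisfiesList.count_eq {k : ℕ} {s t : List ℕ}
    (h : SatisfiesList (LeeMonoid (2 * k + 1)) s t) {x : ℕ} (hx : s.count x ≤ k) :
    s.count x = t.count x := by
  have := h.readWord_eq (fun z => if z = x then [.a, .b] else []) 0
  rw [readWord_count k x s rfl (Nat.zero_le _), readWord_count k x t rfl (Nat.zero_le _)] at this
  omega

/-- The generator `a` for the letter `0`, and `b` for all other letters. -/
def toGen : ℕ → Gen
  | 0 => .a
  | _ => .b

theorem flatMap_eq_map_pairWord (x y : ℕ) (s : List ℕ) :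
    (s.flatMap fun z => if z = x then [Gen.a] else if z = y then [Gen.b] else []) =
      (pairWord x y s).map toGen := by
  induction s with
  | nil => rfl
  | cons a s ih =>
    unfold pairWord at ih ⊢
    rcases eq_or_ne a x with rfl | hx
    · simpa [toGen] using ih
    · rcases eq_or_ne a y with rfl | hy
      · simpa [hx, toGen] using ih
      · simpa [hx, hy] using ih

/-- The action of `L_ℓ¹` separates the words over `{0, 1}` of low multiplicity. -/
def SeparatesBinary (k ℓ : ℕ) : Prop :=
  ∀ r ∈ binaryWords (k + k), ∀ r' ∈ binaryWords (k + k),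
    (r.count 0 ≤ k ∧ r.count 1 ≤ k ∧ r.count 0 = r'.count 0 ∧ r.count 1 = r'.count 1 ∧
      readWord ℓ 0 (r.map toGen) = readWord ℓ 0 (r'.map toGen) ∧
      readWord ℓ 1 (r.map toGen) = readWord ℓ 1 (r'.map toGen)) → r = r'

instance (k ℓ : ℕ) : Decidable (SeparatesBinary k ℓ) := by unfold SeparatesBinary; infer_instance

theorem separatesBinary_one : SeparatesBinary 1 3 := by decide +kernel

theorem separatesBinary_two : SeparatesBinary 2 5 := by decide +kernel

/-- Multiplicities are compared beforehand, so that the restriction of `t` is also short enough for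
the finite check. -/
theorem SeparatesBinary.discriminates {k : ℕ} (hk : SeparatesBinary k (2 * k + 1)) :
    Discriminates k (LeeMonoid (2 * k + 1)) := by
  intro s t h x y hx hy
  have cx := h.count_eq hx
  have cy := h.count_eq hy
  rcases eq_or_ne x y with rfl | hxy
  · simpa [List.filter_beq, ← beq_eq_decide] using cx
  have hr := h.readWord_eq fun z => if z = x then [Gen.a] else if z = y then [Gen.b] else []
  simp only [flatMap_eq_map_pairWord] at hr
  have mem : ∀ l : List ℕ, l.count x ≤ k → l.count y ≤ k →
      pairWord x y l ∈ binaryWords (k + k) := by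
    intro l hx hy
    refine mem_binaryWords (fun z => lt_two_of_mem_pairWord) ?_
    rw [length_eq_count_add_count (fun z => lt_two_of_mem_pairWord), count_zero_pairWord,
      count_one_pairWord hxy]
    omega
  refine filter_eq_of_pairWord_eq (hk _ (mem s hx hy) _ (mem t (cx ▸ hx) (cy ▸ hy))
    ⟨?_, ?_, ?_, ?_, hr 0, hr 1⟩) <;>
  simp only [count_zero_pairWord, count_one_pairWord hxy] <;> assumption

theorem discriminates_lee {k : ℕ} (hk : k = 1 ∨ k = 2) :
    Discriminates k (LeeMonoid (2 * k + 1)) := by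
  rcases hk with rfl | rfl
  · exact separatesBinary_one.discriminates
  · exact separatesBinary_two.discriminates

theorem prod_map_eq_zero {k : ℕ} {s : List ℕ} {x : ℕ} {θ : ℕ → LeeMonoid (2 * k + 1)}
    (hx : k + 1 ≤ s.count x) (h1 : θ x ≠ 1) (hg : ∀ g, θ x ≠ gen (2 * k + 1) g) :
    (s.map θ).prod = zero (2 * k + 1) := by
  refine prod_eq_zero_of_count h1 hg ?_
  rw [← List.map_replicate]
  exact (List.replicate_sublist_iff.2 hx).map θ

/-- In `L¹_{2k+1}` a letter that occurs more than `k` times can be doubled. -/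
theorem satisfiesList_double {k : ℕ} {p q : List ℕ} {x : ℕ}
    (h : k < (p ++ x :: q).count x) :
    SatisfiesList (LeeMonoid (2 * k + 1)) (p ++ x :: q) (p ++ x :: x :: q) := by
  intro θ
  by_cases h1 : θ x = 1
  · simp [h1]
  by_cases hg : ∃ g, θ x = gen (2 * k + 1) g
  · obtain ⟨g, hg⟩ := hg
    simp only [List.map_append, List.map_cons, List.prod_append, List.prod_cons, hg]
    rw [← mul_assoc (gen _ g) (gen _ g), gen_mul_gen]
  · push Not at hg
    rw [prod_map_eq_zero h h1 hg, prod_map_eq_zero (le_trans h ?_) h1 hg]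
    simp

/-- Doubling a high letter gives an identity with a longer word. Without high letters, `LowEquiv k`
is equality. -/
theorem iso_lee {k : ℕ} (hk : k = 1 ∨ k = 2) : iso (LeeMonoid (2 * k + 1)) = boundedWords k := by
  ext w
  constructor
  · intro hw x
    by_contra hx
    obtain ⟨p, q, hpq, -, -⟩ := exists_eq_append_cons_of_lt_count (not_le.1 hx)
    obtain ⟨u, hu⟩ := exists_letters_eq (l := w.toList) (by rw [hpq]; simp)
    obtain ⟨v, hv⟩ := exists_letters_eq (l := p ++ x :: x :: q) (by simp)
    have huv := hw u (by rw [toFreeMonoid_eq_ofList, hu, FreeMonoid.ofList_toList]) v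
      (satisfies_iff.2 (by
        rw [hu, hv, hpq]
        exact satisfiesList_double (hpq ▸ not_le.1 hx)))
    have := congrArg List.length (hu.symm.trans ((congrArg letters huv).trans hv))
    rw [hpq] at this
    simp at this
  · rintro hw u rfl v huv
    have h := (discriminates_lee hk).lowEquiv (satisfies_iff.1 huv)
    refine letters_injective (h.eq fun x => ?_)
    have := hw x
    rwa [toFreeMonoid_eq_ofList, FreeMonoid.toList_ofList] at this

/-! ### Alternating patterns -/

/-- The alternating word of length `m` whose first letter is the one expected in state `n`. -/
def altWord : ℕ → ℕ → List Gen
  | _, 0 => []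
  | n, m + 1 => expected n :: altWord (n + 1) m

/-- The action is greedy matching: the state moves exactly when the next letter of the pattern is
met. -/
theorem altWord_sublist_iff {ℓ : ℕ} (r : List Gen) {n m : ℕ} (h : n + m ≤ ℓ) :
    (altWord n m).Sublist r ↔ n + m ≤ readWord ℓ n r := by
  induction r generalizing n m with
  | nil =>
    cases m with
    | zero => simp [altWord, readWord]
    | succ m => simp [altWord, readWord]
  | cons g r ih =>
    cases m with
    | zero => simpa [altWord] using le_readWord ℓ (g :: r) n
    | succ m =>
      change _ ↔ _ ≤ readWord ℓ (step ℓ g n) r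
      rw [altWord]
      by_cases hg : g = expected n
      · rw [hg, List.cons_sublist_cons, ih (by omega), step_expected (by omega)]
        omega
      · rw [step_of_ne_expected hg, ← ih h, altWord]
        constructor
        · intro hs
          cases hs with
          | cons _ hs => exact hs
          | cons_cons => exact absurd rfl hg
        · exact List.Sublist.cons g

theorem exists_sublist_of_sublist_flatMap (c : ℕ → Option Gen) {p : List Gen} {s : List ℕ}
    (h : p.Sublist (s.flatMap fun z => (c z).toList)) :
    ∃ l : List ℕ, l.Sublist s ∧ l.map c = p.map some := by
  induction s generalizing p with
  | nil => exact ⟨[], List.Sublist.refl _, by simp_all⟩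
  | cons a s ih =>
    rw [List.flatMap_cons] at h
    cases hc : c a with
    | none =>
      obtain ⟨l, hl, hlp⟩ := ih (by simpa [hc] using h)
      exact ⟨l, hl.cons a, hlp⟩
    | some g =>
      rw [hc] at h
      cases h with
      | cons _ h =>
        obtain ⟨l, hl, hlp⟩ := ih h
        exact ⟨l, hl.cons a, hlp⟩
      | cons_cons _ h =>
        obtain ⟨l, hl, hlp⟩ := ih h
        exact ⟨a :: l, hl.cons_cons a, by simp [hc, hlp]⟩

theorem sublist_flatMap_of_sublist (c : ℕ → Option Gen) {p : List Gen} {l s : List ℕ}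
    (hl : l.Sublist s) (hp : l.map c = p.map some) :
    p.Sublist (s.flatMap fun z => (c z).toList) := by
  have : p = l.flatMap fun z => (c z).toList := by
    clear hl
    induction l generalizing p with
    | nil => simp_all
    | cons a l ih =>
      cases p with
      | nil => simp at hp
      | cons g p =>
        simp only [List.map_cons, List.cons.injEq] at hp
        rw [List.flatMap_cons, hp.1, ← ih hp.2]
        rfl
  rw [this]
  exact hl.flatMap _

/-- Identities of `L_ℓ¹` preserve the presence of alternating patterns of length at most `ℓ`. -/
theorem SatisfiesList.exists_pattern {ℓ : ℕ} {s t : List ℕ} (hℓ : 0 < ℓ)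
    (h : SatisfiesList (LeeMonoid ℓ) s t) (c : ℕ → Option Gen) {m : ℕ} (hm : m ≤ ℓ)
    {l : List ℕ} (hl : l.Sublist s) (hlm : l.map c = (altWord 0 m).map some) :
    ∃ l' : List ℕ, l'.Sublist t ∧ l'.map c = (altWord 0 m).map some := by
  obtain ⟨ℓ, rfl⟩ := Nat.exists_eq_succ_of_ne_zero hℓ.ne'
  refine exists_sublist_of_sublist_flatMap c ?_
  have := sublist_flatMap_of_sublist c hl hlm
  rw [altWord_sublist_iff (ℓ := ℓ + 1) _ (by omega)] at this ⊢
  rwa [← SatisfiesList.readWord_eq h]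

/-- The alternating word `xyxy⋯` of length `m`. -/
def zigzag (x y : ℕ) : ℕ → List ℕ
  | 0 => []
  | m + 1 => x :: zigzag y x m

/-- The assignment `x ↦ a`, `y ↦ b`. -/
def twoColor (x y z : ℕ) : Option Gen := if z = x then some .a else if z = y then some .b else none

theorem map_twoColor_zigzag {x y : ℕ} (hxy : x ≠ y) (m n : ℕ) :
    (n % 2 = 0 → (zigzag x y m).map (twoColor x y) = (altWord n m).map some) ∧
    (n % 2 = 1 → (zigzag y x m).map (twoColor x y) = (altWord n m).map some) := by
  induction m generalizing n with
  | zero => exact ⟨fun _ => rfl, fun _ => rfl⟩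
  | succ m ih =>
    constructor <;> intro hn
    · simp [zigzag, altWord, (ih (n + 1)).2 (by omega), twoColor, expected, hn]
    · simp [zigzag, altWord, (ih (n + 1)).1 (by omega), twoColor, expected, hn, hxy.symm]

theorem twoColor_injective {x y z z' : ℕ} {g : Gen} (h : twoColor x y z = some g)
    (h' : twoColor x y z' = some g) : z = z' := by
  unfold twoColor at h h'
  grind

/-- Only `x` has colour `a` and only `y` has colour `b`, so the coloured pattern found in `t` is the
zigzag itself. -/
theorem SatisfiesList.zigzag_sublist {ℓ : ℕ} {s t : List ℕ} (hℓ : 0 < ℓ)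
    (h : SatisfiesList (LeeMonoid ℓ) s t) {x y : ℕ} (hxy : x ≠ y) {m : ℕ} (hm : m ≤ ℓ)
    (hs : (zigzag x y m).Sublist s) : (zigzag x y m).Sublist t := by
  have hz := (map_twoColor_zigzag hxy m 0).1 rfl
  obtain ⟨l, hl, hlm⟩ := h.exists_pattern hℓ (twoColor x y) hm hs hz
  suffices zigzag x y m = l by rwa [this]
  refine eq_of_map_eq (hz.trans hlm.symm) fun a ha b hb hab => ?_
  have : twoColor x y a ∈ (altWord 0 m).map some := hz ▸ List.mem_map_of_mem ha
  obtain ⟨g, -, hg⟩ := List.mem_map.1 this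
  exact twoColor_injective hg.symm (hab ▸ hg.symm)

/-! ### Precedence of letters -/

/-- All occurrences of `x` in `G` precede all occurrences of `y`. -/
def Precedes (G : List ℕ) (x y : ℕ) : Prop := ¬ [y, x].Sublist G

theorem pair_sublist_iff {G : List ℕ} {x y : ℕ} :
    [x, y].Sublist G ↔ ∃ i j : ℕ, i < j ∧ G[i]? = some x ∧ G[j]? = some y := by
  induction G with
  | nil => simp
  | cons a G ih =>
    constructor
    · intro h
      cases h with
      | cons _ h =>
        obtain ⟨i, j, hij, hi, hj⟩ := ih.1 h
        exact ⟨i + 1, j + 1, by omega, by simpa using hi, by simpa using hj⟩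
      | cons_cons _ h =>
        obtain ⟨j, hj⟩ := List.mem_iff_getElem?.1 (List.singleton_sublist.1 h)
        exact ⟨0, j + 1, by omega, by simp, by simpa using hj⟩
    · rintro ⟨i, j, hij, hi, hj⟩
      obtain ⟨j, rfl⟩ := Nat.exists_eq_succ_of_ne_zero (by omega : j ≠ 0)
      rw [Nat.succ_eq_add_one, List.getElem?_cons_succ] at hj
      cases i with
      | zero =>
        rw [List.getElem?_cons_zero, Option.some.injEq] at hi
        subst hi
        exact (List.singleton_sublist.2 (List.mem_of_getElem? hj)).cons_cons a
      | succ i =>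
        rw [List.getElem?_cons_succ] at hi
        exact (ih.2 ⟨i, j, by omega, hi, hj⟩).cons a

/-- `Precedes` is vacuous for absent letters, hence the membership of the middle letter. -/
theorem Precedes.trans {G : List ℕ} {x y z : ℕ} (hy : y ∈ G) (h : Precedes G x y)
    (h' : Precedes G y z) : Precedes G x z := by
  intro hs
  obtain ⟨i, j, hij, hi, hj⟩ := pair_sublist_iff.1 hs
  obtain ⟨m, hm⟩ := List.mem_iff_getElem?.1 hy
  by_cases him : i < m
  · exact h' (pair_sublist_iff.2 ⟨i, m, him, hi, hm⟩)
  · exact h (pair_sublist_iff.2 ⟨m, j, by omega, hm, hj⟩)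

theorem Precedes.asymm {G : List ℕ} {x y : ℕ} (hxy : x ≠ y) (hx : x ∈ G) (hy : y ∈ G)
    (h : Precedes G x y) (h' : Precedes G y x) : False := by
  obtain ⟨i, hi⟩ := List.mem_iff_getElem?.1 hx
  obtain ⟨j, hj⟩ := List.mem_iff_getElem?.1 hy
  rcases lt_trichotomy i j with hij | rfl | hij
  · exact h' (pair_sublist_iff.2 ⟨i, j, hij, hi, hj⟩)
  · exact hxy (Option.some.inj (hi.symm.trans hj))
  · exact h (pair_sublist_iff.2 ⟨j, i, hij, hj, hi⟩)

/-- Disjoint pairs of intervals: the order of the convex hulls of letters is an interval order. -/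
theorem Precedes.or {G : List ℕ} {p q r s : ℕ} (h : Precedes G p q) (h' : Precedes G r s) :
    Precedes G p s ∨ Precedes G r q := by
  by_contra hc
  simp only [Precedes, not_or, not_not] at hc
  obtain ⟨i₁, i₂, h12, h1, h2⟩ := pair_sublist_iff.1 hc.1
  obtain ⟨i₃, i₄, h34, h3, h4⟩ := pair_sublist_iff.1 hc.2
  by_cases h32 : i₃ < i₂
  · exact h (pair_sublist_iff.2 ⟨i₃, i₂, h32, h3, h2⟩)
  · exact h' (pair_sublist_iff.2 ⟨i₁, i₄, by omega, h1, h4⟩)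

theorem precedes_filter_iff {G : List ℕ} {x y : ℕ} {p : ℕ → Bool} (hx : p x) (hy : p y) :
    Precedes (G.filter p) x y ↔ Precedes G x y := by
  refine not_congr ⟨fun h => h.trans List.filter_sublist, fun h => ?_⟩
  simpa [hx, hy] using h.filter p

/-! ### Two chains of letters in three gaps -/

/-- The letters of the first chain. -/
def la (i : ℕ) : ℕ := 2 * i + 2

/-- The letters of the second chain. -/
def lb (i : ℕ) : ℕ := 2 * i + 3

theorem la_ne_lb (i j : ℕ) : la i ≠ lb j := by unfold la lb; omega

theorem la_lt {i j : ℕ} (h : i < j) : la i < la j := by unfold la; omega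

theorem lb_lt {i j : ℕ} (h : i < j) : lb i < lb j := by unfold lb; omega

/-- Three words in the letters of two chains. Each chain is increasing in the first and in the
third word and decreasing in the second one. Two letters of different chains whose hulls are
disjoint in each word appear in the same order in each word. -/
structure GapSystem (n : ℕ) (G : Fin 3 → List ℕ) : Prop where
  la_mem : ∀ h, ∀ i < n, la i ∈ G h
  lb_mem : ∀ h, ∀ i < n, lb i ∈ G h
  la_zero : ∀ i j, i < j → j < n → Precedes (G 0) (la i) (la j)
  la_one : ∀ i j, i < j → j < n → Precedes (G 1) (la j) (la i)
  la_two : ∀ i j, i < j → j < n → Precedes (G 2) (la i) (la j)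
  lb_zero : ∀ i j, i < j → j < n → Precedes (G 0) (lb i) (lb j)
  lb_one : ∀ i j, i < j → j < n → Precedes (G 1) (lb j) (lb i)
  lb_two : ∀ i j, i < j → j < n → Precedes (G 2) (lb i) (lb j)
  same : ∀ i < n, ∀ j < n, (∀ h, Precedes (G h) (la i) (lb j) ∨ Precedes (G h) (lb j) (la i)) →
    (∀ h, Precedes (G h) (la i) (lb j)) ∨ ∀ h, Precedes (G h) (lb j) (la i)

namespace GapSystem

variable {n : ℕ} {G : Fin 3 → List ℕ}

/-- Let `i < k`. The first chain is reversed in the middle word, so there `lb j` precedes `la k`,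
`la i` and `lb l` in turn, which forces `l < j`. In the outer words `la i` precedes `lb l`, then `lb
j`. Thus `la i` and `lb j` have disjoint hulls everywhere but no constant order, against `same`. For
`i > k` the middle and outer words exchange roles; for `i = k` the chain through `la i` alone gives
a contradiction. -/
theorem not_both (H : GapSystem n G) {i l k j : ℕ} (hi : i < n) (hl : l < n) (hk : k < n)
    (hj : j < n) (h₁ : ∀ h, Precedes (G h) (la i) (lb l))
    (h₂ : ∀ h, Precedes (G h) (lb j) (la k)) : False := by
  have asymm : ∀ h, ∀ i < n, ∀ j < n, Precedes (G h) (la i) (lb j) →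
      Precedes (G h) (lb j) (la i) → False := fun h i hi j hj =>
    Precedes.asymm (la_ne_lb i j) (H.la_mem h i hi) (H.lb_mem h j hj)
  have lb_asymm : ∀ h, ∀ i < n, ∀ j < n, i < j → Precedes (G h) (lb i) (lb j) →
      Precedes (G h) (lb j) (lb i) → False := fun h i hi j hj hij =>
    Precedes.asymm (lb_lt hij).ne (H.lb_mem h i hi) (H.lb_mem h j hj)
  rcases lt_trichotomy i k with hik | rfl | hik
  · have a1 : Precedes (G 1) (lb j) (la i) :=
      (h₂ 1).trans (H.la_mem 1 k hk) (H.la_one i k hik hk)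
    have a2 : Precedes (G 1) (lb j) (lb l) := a1.trans (H.la_mem 1 i hi) (h₁ 1)
    rcases lt_trichotomy l j with hlj | rfl | hlj
    · have c0 := (h₁ 0).trans (H.lb_mem 0 l hl) (H.lb_zero l j hlj hj)
      have c2 := (h₁ 2).trans (H.lb_mem 2 l hl) (H.lb_two l j hlj hj)
      rcases H.same i hi j hj (by
        intro h; fin_cases h
        exacts [Or.inl c0, Or.inr a1, Or.inl c2]) with hs | hs
      · exact asymm 1 i hi j hj (hs 1) a1
      · exact asymm 0 i hi j hj c0 (hs 0)
    · exact asymm 1 i hi l hl (h₁ 1) a1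
    · exact lb_asymm 1 j hj l hl hlj a2 (H.lb_one j l hlj hl)
  · have b0 := (h₂ 0).trans (H.la_mem 0 i hi) (h₁ 0)
    have b1 := (h₂ 1).trans (H.la_mem 1 i hi) (h₁ 1)
    rcases lt_trichotomy l j with hlj | rfl | hlj
    · exact lb_asymm 0 l hl j hj hlj (H.lb_zero l j hlj hj) b0
    · exact asymm 0 i hi l hl (h₁ 0) (h₂ 0)
    · exact lb_asymm 1 j hj l hl hlj b1 (H.lb_one j l hlj hl)
  · have a0 : Precedes (G 0) (lb j) (la i) :=
      (h₂ 0).trans (H.la_mem 0 k hk) (H.la_zero k i hik hi)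
    have a2 : Precedes (G 2) (lb j) (la i) :=
      (h₂ 2).trans (H.la_mem 2 k hk) (H.la_two k i hik hi)
    have a0' : Precedes (G 0) (lb j) (lb l) := a0.trans (H.la_mem 0 i hi) (h₁ 0)
    rcases lt_trichotomy l j with hlj | rfl | hlj
    · exact lb_asymm 0 l hl j hj hlj (H.lb_zero l j hlj hj) a0'
    · exact asymm 0 i hi l hl (h₁ 0) a0
    · have c1 := (h₁ 1).trans (H.lb_mem 1 l hl) (H.lb_one j l hlj hl)
      rcases H.same i hi j hj (by
        intro h; fin_cases h
        exacts [Or.inr a0, Or.inl c1, Or.inr a2]) with hs | hs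
      · exact asymm 0 i hi j hj (hs 0) a0
      · exact asymm 1 i hi j hj c1 (hs 1)

/-- Among four pairs of letters forming an antichain, there is one whose letters have disjoint
hulls in each of the three words. -/
theorem exists_same (H : GapSystem n G) {f g : Fin 4 → ℕ} (hf : StrictMono f) (hg : StrictMono g)
    (hfn : ∀ x, f x < n) (hgn : ∀ x, g x < n) :
    ∃ x y, (∀ h, Precedes (G h) (la (f x)) (lb (g y))) ∨
      ∀ h, Precedes (G h) (lb (g y)) (la (f x)) := by
  -- Pairing in opposite orders makes any two of the four pairs incomparable, so by `Precedes.or` at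
  -- most one pair overlaps in each word.
  suffices ∃ x : Fin 4, ∀ h, Precedes (G h) (la (f x)) (lb (g x.rev)) ∨
      Precedes (G h) (lb (g x.rev)) (la (f x)) by
    obtain ⟨x, hx⟩ := this
    exact ⟨x, x.rev, H.same _ (hfn x) _ (hgn _) hx⟩
  have key : ∀ h, ∀ x y : Fin 4, x < y →
      (Precedes (G h) (la (f x)) (lb (g x.rev)) ∨ Precedes (G h) (lb (g x.rev)) (la (f x))) ∨
      (Precedes (G h) (la (f y)) (lb (g y.rev)) ∨ Precedes (G h) (lb (g y.rev)) (la (f y))) := by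
    intro h x y hxy
    have h1 := hf hxy
    have h2 := hg (Fin.rev_lt_rev.2 hxy)
    fin_cases h
    · rcases (H.la_zero _ _ h1 (hfn y)).or (H.lb_zero _ _ h2 (hgn _)) with h | h
      exacts [Or.inl (Or.inl h), Or.inr (Or.inr h)]
    · rcases (H.la_one _ _ h1 (hfn y)).or (H.lb_one _ _ h2 (hgn _)) with h | h
      exacts [Or.inr (Or.inl h), Or.inl (Or.inr h)]
    · rcases (H.la_two _ _ h1 (hfn y)).or (H.lb_two _ _ h2 (hgn _)) with h | h
      exacts [Or.inl (Or.inl h), Or.inr (Or.inr h)]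
  by_contra hc
  push Not at hc
  choose h hh using hc
  -- Four overlapping pairs and three words: two pairs would overlap in the same word.
  obtain ⟨x, y, hxy, he⟩ : ∃ x y : Fin 4, x < y ∧ h x = h y := by
    obtain ⟨x, y, hne, he⟩ := Fintype.exists_ne_map_eq_of_card_lt h (by simp)
    rcases lt_or_gt_of_ne hne with hl | hl
    exacts [⟨x, y, hl, he⟩, ⟨y, x, hl, he.symm⟩]
  rcases key (h x) x y hxy with (k | k) | (k | k)
  · exact (hh x).1 k
  · exact (hh x).2 k
  · exact (hh y).1 (he ▸ k)
  · exact (hh y).2 (he ▸ k)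

end GapSystem

/-! ### Alternating patterns in concatenations -/

/-- As `G` has no scattered `yx`, it can supply only the first letter of `yxyx⋯`. -/
theorem Precedes.zigzag_sublist_of_append {G R : List ℕ} {x y m : ℕ} (h : Precedes G x y)
    (hs : (zigzag y x (m + 1)).Sublist (G ++ R)) : (zigzag x y m).Sublist R := by
  obtain ⟨p, q, hpq, hp, hq⟩ := List.sublist_append_iff.1 hs
  rcases p with _ | ⟨a, _ | ⟨b, p⟩⟩
  · rw [List.nil_append] at hpq
    subst hpq
    exact (List.sublist_cons_self _ _).trans hq
  · simp only [zigzag, List.cons_append, List.nil_append, List.cons.injEq] at hpq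
    rwa [hpq.2]
  · cases m with
    | zero => simp [zigzag] at hpq
    | succ m =>
      simp only [zigzag, List.cons_append, List.cons.injEq] at hpq
      obtain ⟨rfl, rfl, -⟩ := hpq
      exact absurd (List.Sublist.trans (by simp) hp) h

theorem Precedes.zigzag_sublist_of_append' {G R : List ℕ} {x y m : ℕ} (h : Precedes G x y)
    (hs : (zigzag x y (m + 2)).Sublist (G ++ R)) : (zigzag x y m).Sublist R :=
  h.zigzag_sublist_of_append ((List.sublist_cons_self _ _).trans hs)

/-- The words with separators: `G₀ 0 G₁` if `k = 1`, and `G₀ 0 G₁ 1 G₂` otherwise. -/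
def frame (k : ℕ) (G₀ G₁ G₂ : List ℕ) : List ℕ :=
  G₀ ++ 0 :: (G₁ ++ if k = 1 then [] else 1 :: G₂)

theorem zigzag_two_le {x y m z : ℕ} (hx : 2 ≤ x) (hy : 2 ≤ y) (hz : z ∈ zigzag x y m) : 2 ≤ z := by
  induction m generalizing x y with
  | zero => simp [zigzag] at hz
  | succ m ih =>
    rcases List.mem_cons.1 hz with rfl | hz
    exacts [hx, ih hy hx hz]

theorem zigzag_sublist_of_frame_one {G₀ G₁ G₂ : List ℕ} {x y m : ℕ} (hx : 2 ≤ x) (hy : 2 ≤ y)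
    (h : (zigzag x y m).Sublist (frame 1 G₀ G₁ G₂)) : (zigzag x y m).Sublist (G₀ ++ G₁) := by
  have := h.filter (fun z => 2 ≤ z)
  rw [List.filter_eq_self.2 fun z hz => by simpa using zigzag_two_le hx hy hz] at this
  simp only [frame, if_true, List.append_nil, List.filter_append] at this
  rw [List.filter_cons_of_neg (by simp)] at this
  exact this.trans (List.filter_sublist.append List.filter_sublist)

theorem zigzag_sublist_of_frame_two {G₀ G₁ G₂ : List ℕ} {x y m : ℕ} (hx : 2 ≤ x) (hy : 2 ≤ y)
    (h : (zigzag x y m).Sublist (frame 2 G₀ G₁ G₂)) :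
    (zigzag x y m).Sublist (G₀ ++ (G₁ ++ G₂)) := by
  have := h.filter (fun z => 2 ≤ z)
  rw [List.filter_eq_self.2 fun z hz => by simpa using zigzag_two_le hx hy hz] at this
  simp only [frame, OfNat.ofNat_ne_one, if_false, List.filter_append] at this
  rw [List.filter_cons_of_neg (by simp), List.filter_append,
    List.filter_cons_of_neg (by simp)] at this
  exact this.trans (List.filter_sublist.append (List.filter_sublist.append List.filter_sublist))

/-- A letter that precedes `y` in the gaps of odd number and is preceded by `y` in the other gaps
forms short patterns with `y` only. -/
theorem not_zigzag_sublist_frame {k : ℕ} (hk : k = 1 ∨ k = 2) {G₀ G₁ G₂ : List ℕ} {x y : ℕ}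
    (hx : 2 ≤ x) (hy : 2 ≤ y) (h₀ : Precedes G₀ x y) (h₁ : Precedes G₁ y x)
    (h₂ : Precedes G₂ x y) : ¬ (zigzag y x (k + 2)).Sublist (frame k G₀ G₁ G₂) := by
  intro hs
  rcases hk with rfl | rfl
  · exact h₁ (h₀.zigzag_sublist_of_append (zigzag_sublist_of_frame_one hy hx hs))
  · exact h₂ (h₁.zigzag_sublist_of_append
      (h₀.zigzag_sublist_of_append (zigzag_sublist_of_frame_two hy hx hs)))

/-- A gap in the wrong order supplies two letters and each of the `k` other gaps one, which makes a
zigzag of length `k + 2`. -/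
theorem precedes_of_not_zigzag {k : ℕ} (hk : k = 1 ∨ k = 2) {G₀ G₁ G₂ : List ℕ} {x y : ℕ}
    (hx : x ∈ G₀ ∧ x ∈ G₁ ∧ (k = 1 ∨ x ∈ G₂)) (hy : y ∈ G₀ ∧ y ∈ G₁ ∧ (k = 1 ∨ y ∈ G₂))
    (h : ¬ (zigzag y x (k + 2)).Sublist (frame k G₀ G₁ G₂)) :
    Precedes G₀ x y ∧ Precedes G₁ y x ∧ (k = 1 ∨ Precedes G₂ x y) := by
  have s : ∀ {z : ℕ} {G : List ℕ}, z ∈ G → [z].Sublist G := List.singleton_sublist.2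
  rcases hk with rfl | rfl
  · simp only [frame, if_true, List.append_nil] at h
    refine ⟨fun h0 => h ?_, fun h1 => h ?_, Or.inl rfl⟩
    · exact h0.append ((s hy.2.1).cons 0)
    · exact (s hy.1).append (h1.cons 0)
  · simp only [frame, OfNat.ofNat_ne_one, if_false, false_or] at h hx hy ⊢
    refine ⟨fun h0 => h ?_, fun h1 => h ?_, fun h2 => h ?_⟩
    · exact h0.append (((s hy.2.1).append ((s hx.2.2).cons 1)).cons 0)
    · exact (s hy.1).append ((h1.append ((s hx.2.2).cons 1)).cons 0)
    · exact (s hy.1).append (((s hx.2.1).append (h2.cons 1)).cons 0)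

theorem not_precedes_of_zigzag_one {G₀ G₁ G₂ : List ℕ} {x y : ℕ} (hx : 2 ≤ x) (hy : 2 ≤ y)
    (h : (zigzag y x 3).Sublist (frame 1 G₀ G₁ G₂)) (h₀ : Precedes G₀ x y)
    (h₁ : Precedes G₁ y x) : False :=
  h₁ (h₀.zigzag_sublist_of_append (zigzag_sublist_of_frame_one hy hx h))

/-- A gap with separated letters supplies at most two letters of a zigzag, and only one if the order
is wrong for the next letter due. Here the first gap supplies one of the five, so the others may not
waste any. -/
theorem not_precedes_of_zigzag_two {G₀ G₁ G₂ : List ℕ} {x y : ℕ} (hx : 2 ≤ x) (hy : 2 ≤ y)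
    (h : (zigzag y x 5).Sublist (frame 2 G₀ G₁ G₂)) (h₀ : Precedes G₀ x y) :
    (Precedes G₁ y x → ¬ Precedes G₂ x y) ∧ (Precedes G₁ y x → ¬ Precedes G₂ y x) ∧
      (Precedes G₁ x y → ¬ Precedes G₂ y x) := by
  have h := h₀.zigzag_sublist_of_append (zigzag_sublist_of_frame_two hy hx h)
  refine ⟨fun h₁ h₂ => h₂ ?_, fun h₁ h₂ => h₂ ?_, fun h₁ h₂ => h₂ ?_⟩
  · exact List.Sublist.trans (by simp [zigzag]) (h₁.zigzag_sublist_of_append h)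
  · exact List.Sublist.trans (by simp [zigzag]) (h₁.zigzag_sublist_of_append h)
  · exact h₁.zigzag_sublist_of_append' h

/-! ### The words `U` and `V` -/

/-- The first chain of letters. -/
def chainA (n : ℕ) : List ℕ := (List.range n).map la

/-- The second chain of letters. -/
def chainB (n : ℕ) : List ℕ := (List.range n).map lb

/-- The word `P 0 Q` or `P 0 Q 1 P`, where `P` consists of the two chains, the first chain first,
and `Q` of the two reversed chains. -/
def wordU (k n : ℕ) : List ℕ :=
  frame k (chainA n ++ chainB n) ((chainA n).reverse ++ (chainB n).reverse)
    (chainA n ++ chainB n)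

/-- The word obtained from `wordU k n` by exchanging the two chains within each gap. -/
def wordV (k n : ℕ) : List ℕ :=
  frame k (chainB n ++ chainA n) ((chainB n).reverse ++ (chainA n).reverse)
    (chainB n ++ chainA n)

theorem mem_chainA {n z : ℕ} : z ∈ chainA n ↔ ∃ i < n, z = la i := by
  simp [chainA, eq_comm]

theorem mem_chainB {n z : ℕ} : z ∈ chainB n ↔ ∃ i < n, z = lb i := by
  simp [chainB, eq_comm]

theorem la_mem_chainA {n i : ℕ} (hi : i < n) : la i ∈ chainA n := mem_chainA.2 ⟨i, hi, rfl⟩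

theorem lb_mem_chainB {n i : ℕ} (hi : i < n) : lb i ∈ chainB n := mem_chainB.2 ⟨i, hi, rfl⟩

theorem la_notMem_chainB (n i : ℕ) : la i ∉ chainB n := fun h => by
  obtain ⟨j, -, hj⟩ := mem_chainB.1 h
  exact la_ne_lb i j hj

theorem lb_notMem_chainA (n i : ℕ) : lb i ∉ chainA n := fun h => by
  obtain ⟨j, -, hj⟩ := mem_chainA.1 h
  exact la_ne_lb j i hj.symm

theorem notMem_chainA_of_lt_two {n z : ℕ} (hz : z < 2) : z ∉ chainA n := fun h => by
  obtain ⟨i, -, rfl⟩ := mem_chainA.1 h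
  simp [la] at hz

theorem notMem_chainB_of_lt_two {n z : ℕ} (hz : z < 2) : z ∉ chainB n := fun h => by
  obtain ⟨i, -, rfl⟩ := mem_chainB.1 h
  simp [lb] at hz

theorem precedes_of_pairwise_lt {G : List ℕ} (hG : G.Pairwise (· < ·)) {x y : ℕ} (h : x < y) :
    Precedes G x y := fun hs => by
  have := hG.sublist hs
  simp only [List.pairwise_cons, List.mem_singleton, forall_eq] at this
  omega

theorem Precedes.reverse {G : List ℕ} {x y : ℕ} (h : Precedes G x y) :
    Precedes G.reverse y x := fun hs => h (by simpa using hs.reverse)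

theorem Precedes.append_right {G R : List ℕ} {x y : ℕ} (h : Precedes G x y) (hx : x ∉ R)
    (hy : y ∉ R) : Precedes (G ++ R) x y := by
  intro hs
  have := hs.filter (fun z => z ∉ R)
  rw [List.filter_append, (List.filter_eq_nil_iff (l := R)).2 (by simp)] at this
  simp only [List.append_nil] at this
  exact h (List.Sublist.trans (by simp [hx, hy]) (this.trans List.filter_sublist))

theorem Precedes.append_left {G R : List ℕ} {x y : ℕ} (h : Precedes G x y) (hx : x ∉ R)
    (hy : y ∉ R) : Precedes (R ++ G) x y := by
  intro hs
  have := hs.filter (fun z => z ∉ R)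
  rw [List.filter_append, (List.filter_eq_nil_iff (l := R)).2 (by simp)] at this
  exact h (List.Sublist.trans (by simp [hx, hy]) (this.trans List.filter_sublist))

theorem precedes_append {P Q : List ℕ} {x y : ℕ} (hx : x ∉ Q) (hy : y ∉ P) :
    Precedes (P ++ Q) x y := by
  intro hs
  obtain ⟨p, q, hpq, hp, hq⟩ := List.sublist_append_iff.1 hs
  rcases p with _ | ⟨a, p⟩
  · rw [List.nil_append] at hpq
    exact hx (hq.subset (by simp [← hpq]))
  · simp only [List.cons_append, List.cons.injEq] at hpq
    exact hy (hp.subset (by simp [hpq.1]))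

theorem pairwise_chainA (n : ℕ) : (chainA n).Pairwise (· < ·) :=
  List.pairwise_map.2 (List.pairwise_lt_range.imp la_lt)

theorem pairwise_chainB (n : ℕ) : (chainB n).Pairwise (· < ·) :=
  List.pairwise_map.2 (List.pairwise_lt_range.imp lb_lt)

section Frame

variable {k n : ℕ}

theorem not_zigzag_wordU_la (hk : k = 1 ∨ k = 2) {i j : ℕ} (hij : i < j) :
    ¬ (zigzag (la j) (la i) (k + 2)).Sublist (wordU k n) := by
  have h := (precedes_of_pairwise_lt (pairwise_chainA n) (la_lt hij))
  have h₀ := h.append_right (la_notMem_chainB n i) (la_notMem_chainB n j)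
  exact not_zigzag_sublist_frame hk (by simp [la]) (by simp [la]) h₀
    (h.reverse.append_right (by simpa using la_notMem_chainB n j)
      (by simpa using la_notMem_chainB n i)) h₀

theorem not_zigzag_wordU_lb (hk : k = 1 ∨ k = 2) {i j : ℕ} (hij : i < j) :
    ¬ (zigzag (lb j) (lb i) (k + 2)).Sublist (wordU k n) := by
  have h := (precedes_of_pairwise_lt (pairwise_chainB n) (lb_lt hij))
  have h₀ := h.append_left (lb_notMem_chainA n i) (lb_notMem_chainA n j)
  exact not_zigzag_sublist_frame hk (by simp [lb]) (by simp [lb]) h₀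
    (h.reverse.append_left (by simpa using lb_notMem_chainA n j)
      (by simpa using lb_notMem_chainA n i)) h₀

theorem pair_sublist_append {P Q : List ℕ} {x y : ℕ} (hx : x ∈ P) (hy : y ∈ Q) :
    [x, y].Sublist (P ++ Q) :=
  (List.singleton_sublist.2 hx).append (List.singleton_sublist.2 hy)

/-- If `xy` is a scattered subword of each gap, then `xyxy⋯` of length `2 * k + 2` is a scattered
subword of the framed word. -/
theorem zigzag_sublist_frame (hk : k = 1 ∨ k = 2) {G₀ G₁ : List ℕ} {x y : ℕ}
    (h₀ : [x, y].Sublist G₀) (h₁ : [x, y].Sublist G₁) :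
    (zigzag x y (2 * k + 2)).Sublist (frame k G₀ G₁ G₀) := by
  rcases hk with rfl | rfl
  · simp only [frame, if_true, List.append_nil]
    exact h₀.append (h₁.cons 0)
  · exact h₀.append ((h₁.append (h₀.cons 1)).cons 0)

theorem zigzag_wordU (hk : k = 1 ∨ k = 2) {i j : ℕ} (hi : i < n) (hj : j < n) :
    (zigzag (la i) (lb j) (2 * k + 2)).Sublist (wordU k n) :=
  zigzag_sublist_frame hk (pair_sublist_append (la_mem_chainA hi) (lb_mem_chainB hj))
    (pair_sublist_append (by simpa using la_mem_chainA hi) (by simpa using lb_mem_chainB hj))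

theorem zigzag_wordV (hk : k = 1 ∨ k = 2) {i j : ℕ} (hi : i < n) (hj : j < n) :
    (zigzag (lb j) (la i) (2 * k + 2)).Sublist (wordV k n) :=
  zigzag_sublist_frame hk (pair_sublist_append (lb_mem_chainB hj) (la_mem_chainA hi))
    (pair_sublist_append (by simpa using lb_mem_chainB hj) (by simpa using la_mem_chainA hi))

theorem zigzag_sublist_zigzag (x y : ℕ) {m m' : ℕ} (h : m ≤ m') :
    (zigzag x y m).Sublist (zigzag x y m') := by
  induction m generalizing x y m' with
  | zero => exact List.nil_sublist _
  | succ m ih =>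
    obtain ⟨m', rfl⟩ := Nat.exists_eq_succ_of_ne_zero (by omega : m' ≠ 0)
    exact (ih y x (by omega)).cons_cons x

theorem zigzag_swap_sublist (x y m : ℕ) : (zigzag y x m).Sublist (zigzag x y (m + 1)) :=
  List.sublist_cons_self _ _

theorem count_frame_le (hk : k = 1 ∨ k = 2) {G₀ G₁ : List ℕ} {z : ℕ} (h₀ : z ∈ G₀)
    (h₁ : z ∈ G₁) : k + 1 ≤ (frame k G₀ G₁ G₀).count z := by
  have h₀ := List.count_pos_iff.2 h₀
  have h₁ := List.count_pos_iff.2 h₁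
  rcases hk with rfl | rfl
  · simp only [frame, if_true, List.append_nil, List.count_append, List.count_cons]
    omega
  · simp only [frame, OfNat.ofNat_ne_one, if_false, List.count_append, List.count_cons]
    omega

end Frame

/-! ### The identity `U ≈ V` -/

theorem prod_append_comm {M : Type*} [Monoid M] {θ : ℕ → M} {P Q : List ℕ}
    (h : ∀ x ∈ P, ∀ y ∈ Q, Commute (θ x) (θ y)) :
    ((P ++ Q).map θ).prod = ((Q ++ P).map θ).prod := by
  rw [List.map_append, List.map_append, List.prod_append, List.prod_append]
  refine (Commute.list_prod_left _ _ fun x hx => Commute.list_prod_right _ _ fun y hy => ?_).eq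
  obtain ⟨x', hx', rfl⟩ := List.mem_map.1 hx
  obtain ⟨y', hy', rfl⟩ := List.mem_map.1 hy
  exact h x' hx' y' hy'

/-- The length exceeds `ℓ = 2k + 1` by one because the alternation may begin with `b`, which state 0
ignores. -/
theorem prod_map_zigzag_eq_zero {k : ℕ} (hk : k = 1 ∨ k = 2) {θ : ℕ → LeeMonoid (2 * k + 1)}
    {x y : ℕ} {g g' : Gen} (hx : θ x = gen _ g) (hy : θ y = gen _ g') (hg : g ≠ g') {s : List ℕ}
    (hs : (zigzag x y (2 * k + 2)).Sublist s) : (s.map θ).prod = zero (2 * k + 1) := by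
  refine eq_zero_of_le_act (le_trans ?_ (act_prod_le_of_sublist (hs.map θ) 0))
  rcases hk with rfl | rfl <;> cases g <;> cases g' <;>
    simp [zigzag, hx, hy, act_mul, act_gen, step] at hg ⊢

/-- A chain letter valued outside `1`, `a`, `b` kills both sides, as it occurs `k + 1` times. So do
letters of different chains valued `a` and `b`, by their long zigzag. In the remaining case the
chains commute gap by gap. -/
theorem satisfiesList_wordU_wordV {k : ℕ} (hk : k = 1 ∨ k = 2) (n : ℕ) :
    SatisfiesList (LeeMonoid (2 * k + 1)) (wordU k n) (wordV k n) := by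
  intro θ
  by_cases hz : ∃ z, (z ∈ chainA n ∨ z ∈ chainB n) ∧ θ z ≠ 1 ∧ ∀ g, θ z ≠ gen _ g
  · obtain ⟨z, hz, h1, hg⟩ := hz
    rw [wordU, wordV, prod_map_eq_zero (count_frame_le hk ?_ ?_) h1 hg,
      prod_map_eq_zero (count_frame_le hk ?_ ?_) h1 hg] <;>
    simpa [or_comm] using hz
  push Not at hz
  by_cases hab : ∃ i < n, ∃ j < n, ∃ g g', θ (la i) = gen _ g ∧ θ (lb j) = gen _ g' ∧ g ≠ g'
  · obtain ⟨i, hi, j, hj, g, g', h, h', hne⟩ := hab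
    rw [prod_map_zigzag_eq_zero hk h h' hne (zigzag_wordU hk hi hj),
      prod_map_zigzag_eq_zero hk h' h hne.symm (zigzag_wordV hk hi hj)]
  push Not at hab
  have comm : ∀ x ∈ chainA n, ∀ y ∈ chainB n, Commute (θ x) (θ y) := by
    intro x hx y hy
    by_cases hx1 : θ x = 1
    · rw [hx1]; exact Commute.one_left _
    by_cases hy1 : θ y = 1
    · rw [hy1]; exact Commute.one_right _
    obtain ⟨g, hg⟩ := hz x (Or.inl hx) hx1
    obtain ⟨g', hg'⟩ := hz y (Or.inr hy) hy1
    obtain ⟨i, hi, rfl⟩ := mem_chainA.1 hx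
    obtain ⟨j, hj, rfl⟩ := mem_chainB.1 hy
    rw [hg, hg', hab i hi j hj g g' hg hg']
  have h₀ := prod_append_comm comm
  have h₁ := prod_append_comm (θ := θ) (P := (chainA n).reverse) (Q := (chainB n).reverse)
    (fun x hx y hy => comm x (List.mem_reverse.1 hx) y (List.mem_reverse.1 hy))
  simp only [wordU, wordV, frame]
  rcases hk with rfl | rfl
  · simp only [if_true, List.append_nil]
    rw [List.map_append, List.prod_append, List.map_cons, List.prod_cons, h₀, h₁]
    simp only [List.map_append, List.prod_append, List.map_cons, List.prod_cons]
  · simp only [OfNat.ofNat_ne_one, if_false]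
    rw [List.map_append, List.prod_append, List.map_cons, List.prod_cons,
      List.map_append (l₁ := (chainA n).reverse ++ _), List.prod_append, List.map_cons,
      List.prod_cons, h₀, h₁]
    simp only [List.map_append, List.prod_append, List.map_cons, List.prod_cons]

/-! ### The gaps of a word equivalent to `U` -/

/-- The part of a word before the first occurrence of `c`. -/
def before (c : ℕ) (w : List ℕ) : List ℕ := w.takeWhile (· ≠ c)

/-- The part of a word after the first occurrence of `c`. -/
def after (c : ℕ) (w : List ℕ) : List ℕ := (w.dropWhile (· ≠ c)).tail

theorem before_append_cons {c : ℕ} {p : List ℕ} (hp : c ∉ p) (q : List ℕ) :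
    before c (p ++ c :: q) = p := by
  induction p with
  | nil => simp [before]
  | cons a p ih =>
    simp only [List.mem_cons, not_or] at hp
    have := ih hp.2
    simp_all [before, Ne.symm hp.1]

theorem after_append_cons {c : ℕ} {p : List ℕ} (hp : c ∉ p) (q : List ℕ) :
    after c (p ++ c :: q) = q := by
  induction p with
  | nil => simp [after]
  | cons a p ih =>
    simp only [List.mem_cons, not_or] at hp
    have := ih hp.2
    simp_all [after, Ne.symm hp.1]

theorem before_filter {c : ℕ} {p : ℕ → Bool} (hc : p c) (w : List ℕ) :
    before c (w.filter p) = (before c w).filter p := by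
  induction w with
  | nil => rfl
  | cons a w ih =>
    unfold before at ih ⊢
    by_cases ha : a = c
    · subst ha; simp [hc]
    · cases hp : p a <;> simp [hp, ha] <;> simpa using ih

theorem after_filter {c : ℕ} {p : ℕ → Bool} (hc : p c) (w : List ℕ) :
    after c (w.filter p) = (after c w).filter p := by
  induction w with
  | nil => rfl
  | cons a w ih =>
    unfold after at ih ⊢
    by_cases ha : a = c
    · subst ha; simp [hc]
    · cases hp : p a <;> simp [hp, ha] <;> simpa using ih

/-- The gaps between the separators `0` and `1`. If `k = 1`, then the only separator is `0`, and
the third gap is the first one. -/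
def gap (k : ℕ) (w : List ℕ) : Fin 3 → List ℕ :=
  ![before 0 w, if k = 1 then after 0 w else before 1 (after 0 w),
    if k = 1 then before 0 w else after 1 (after 0 w)]

theorem gap_filter {k : ℕ} {p : ℕ → Bool} (h0 : p 0) (h1 : p 1) (w : List ℕ) (h : Fin 3) :
    gap k (w.filter p) h = (gap k w h).filter p := by
  fin_cases h <;> simp only [gap] <;> by_cases hk : k = 1 <;>
    simp [hk, before_filter h0, after_filter h0, before_filter h1, after_filter h1]

theorem gap_frame {k : ℕ} (hk : k = 1 ∨ k = 2) {G₀ G₁ G₂ : List ℕ} (h0 : 0 ∉ G₀) (h1 : 1 ∉ G₁) :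
    gap k (frame k G₀ G₁ G₂) 0 = G₀ ∧ gap k (frame k G₀ G₁ G₂) 1 = G₁ ∧
      gap k (frame k G₀ G₁ G₂) 2 = if k = 1 then G₀ else G₂ := by
  rcases hk with rfl | rfl <;>
    simp [gap, frame, before_append_cons h0, after_append_cons h0, before_append_cons h1,
      after_append_cons h1]

/-- The right-hand word has a single `c`, so any embedding matches the two displayed occurrences. -/
theorem sublist_of_append_cons {c : ℕ} {p q p' q' : List ℕ} (hp : c ∉ p) (hp' : c ∉ p')
    (hq' : c ∉ q') (h : (p ++ c :: q).Sublist (p' ++ c :: q')) : p.Sublist p' ∧ q.Sublist q' := by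
  induction p' generalizing p with
  | nil =>
    cases p with
    | nil => exact ⟨List.Sublist.refl _, List.cons_sublist_cons.1 h⟩
    | cons a p =>
      simp only [List.nil_append, List.cons_append] at h
      cases h with
      | cons _ h => exact absurd (h.subset (by simp)) hq'
      | cons_cons => exact absurd (by simp) hp
  | cons b p' ih =>
    simp only [List.mem_cons, not_or] at hp'
    cases p with
    | nil =>
      simp only [List.nil_append, List.cons_append] at h
      cases h with
      | cons _ h => exact ⟨List.nil_sublist _, (ih (p := []) (by simp) hp'.2 h).2⟩
      | cons_cons => exact absurd rfl hp'.1
    | cons a p =>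
      simp only [List.cons_append] at h
      cases h with
      | cons _ h =>
        have := ih (p := a :: p) hp hp'.2 h
        exact ⟨this.1.cons b, this.2⟩
      | cons_cons _ h =>
        have := ih (p := p) (fun hc => hp (by simp [hc])) hp'.2 h
        exact ⟨this.1.cons_cons _, this.2⟩

section Equivalent

variable {k n : ℕ} {w : List ℕ}

theorem count_wordU (hk : k = 1 ∨ k = 2) (n : ℕ) :
    (wordU k n).count 0 = 1 ∧ (wordU k n).count 1 = k - 1 := by
  have hA : ∀ z < 2, (chainA n).count z = 0 := fun z hz =>
    List.count_eq_zero_of_not_mem (notMem_chainA_of_lt_two hz)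
  have hB : ∀ z < 2, (chainB n).count z = 0 := fun z hz =>
    List.count_eq_zero_of_not_mem (notMem_chainB_of_lt_two hz)
  rcases hk with rfl | rfl <;> simp [wordU, frame, hA, hB]

theorem SatisfiesList.count_separators (hk : k = 1 ∨ k = 2)
    (h : SatisfiesList (LeeMonoid (2 * k + 1)) (wordU k n) w) :
    w.count 0 = 1 ∧ w.count 1 = k - 1 := by
  have hc := count_wordU hk n
  have h0 := h.count_eq (x := 0) (by omega)
  have h1 := h.count_eq (x := 1) (by omega)
  omega

/-- Separators are low, so their multiplicities persist; for `k = 2` their order persists by the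
pattern `01`. -/
theorem SatisfiesList.exists_frame (hk : k = 1 ∨ k = 2)
    (h : SatisfiesList (LeeMonoid (2 * k + 1)) (wordU k n) w) :
    ∃ G₀ G₁ G₂, w = frame k G₀ G₁ G₂ ∧ (k = 1 → G₂ = G₀) ∧
      ∀ z < 2, z ∉ G₀ ∧ z ∉ G₁ ∧ z ∉ G₂ := by
  have hc := h.count_separators hk
  obtain ⟨G₀, R, rfl, hG₀, -⟩ := exists_eq_append_cons_of_lt_count (n := 0) (x := 0) (l := w)
    (by omega)
  have hR : 0 ∉ R := by
    have := hc.1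
    rw [List.count_append, List.count_cons_self] at this
    exact List.count_eq_zero.1 (by omega)
  rcases hk with rfl | rfl
  · have h1 : 1 ∉ G₀ ++ 0 :: R := List.count_eq_zero.1 hc.2
    simp only [List.mem_append, List.mem_cons, not_or] at h1
    refine ⟨G₀, R, G₀, by simp [frame], fun _ => rfl, fun z hz => ?_⟩
    interval_cases z
    exacts [⟨hG₀, hR, hG₀⟩, ⟨h1.1, h1.2.2, h1.1⟩]
  · have h01 : (zigzag 0 1 2).Sublist (G₀ ++ 0 :: R) :=
      h.zigzag_sublist (by omega) (by omega) (by omega)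
        (((List.nil_sublist _).append ((((List.nil_sublist _).append
          ((List.nil_sublist _).cons_cons 1))).cons_cons 0)))
    have h1R := (sublist_of_append_cons (p := []) (by simp) hG₀ hR h01).2
    have h1c := List.count_pos_iff.2 (List.singleton_sublist.1 h1R)
    have hc2 := hc.2
    rw [List.count_append, List.count_cons_of_ne (by omega)] at hc2
    obtain ⟨G₁, G₂, rfl, hG₁, -⟩ := exists_eq_append_cons_of_lt_count (n := 0) (x := 1) (l := R)
      (by omega)
    rw [List.count_append, List.count_cons_self] at hc2
    have h1G₀ : 1 ∉ G₀ := List.count_eq_zero.1 (by omega)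
    have h1G₂ : 1 ∉ G₂ := List.count_eq_zero.1 (by omega)
    simp only [List.mem_append, List.mem_cons, not_or] at hR
    refine ⟨G₀, G₁, G₂, by simp [frame], by omega, fun z hz => ?_⟩
    interval_cases z
    exacts [⟨hG₀, hR.1, hR.2.2⟩, ⟨h1G₀, hG₁, h1G₂⟩]

/-- The letter `x` is sent to `a`, the separators are sent to `b`. -/
def separatorColor (x z : ℕ) : Option Gen :=
  if z = x then some .a else if z < 2 then some .b else none

theorem mem_gaps (hk : k = 1 ∨ k = 2) {G₀ G₁ G₂ : List ℕ}
    (h : SatisfiesList (LeeMonoid (2 * k + 1)) (wordU k n) (frame k G₀ G₁ G₂))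
    (hG : k = 1 → G₂ = G₀) (hs : ∀ z < 2, z ∉ G₀ ∧ z ∉ G₁ ∧ z ∉ G₂) {z : ℕ}
    (hz : z ∈ chainA n ∨ z ∈ chainB n) : z ∈ G₀ ∧ z ∈ G₁ ∧ z ∈ G₂ := by
  have hz2 : 2 ≤ z := by
    by_contra hz2
    exact hz.elim (notMem_chainA_of_lt_two (by omega)) (notMem_chainB_of_lt_two (by omega))
  have s₀ : [z].Sublist (chainA n ++ chainB n) := by simpa using hz
  have s₁ : [z].Sublist ((chainA n).reverse ++ (chainB n).reverse) := by simpa using hz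
  rcases hk with rfl | rfl
  · obtain rfl := hG rfl
    have hU : (zigzag z 0 3).Sublist (wordU 1 n) := by
      simp only [wordU, frame, if_true, List.append_nil]
      exact s₀.append (s₁.cons_cons 0)
    have := h.zigzag_sublist (by omega) (by omega) le_rfl hU
    simp only [frame, if_true, List.append_nil] at this
    have := sublist_of_append_cons (p := [z]) (q := [z]) (by simp; omega) (hs 0 (by omega)).1
      (hs 0 (by omega)).2.1 this
    simp only [List.singleton_sublist] at this
    exact ⟨this.1, this.2, this.1⟩
  -- Giving both separators the colour `b` makes this an alternating pattern of the maximal length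
  -- 5. The pattern found in `w` can only use `0` and then `1`, the sole separators there, so `z`
  -- lies in each gap.
  · have hU : [z, 0, z, 1, z].Sublist (wordU 2 n) :=
      s₀.append ((s₁.append (s₀.cons_cons 1)).cons_cons 0)
    obtain ⟨l, hl, hlm⟩ := h.exists_pattern (by omega) (separatorColor z) (m := 5) le_rfl hU (by
      simp [separatorColor, altWord, expected, show 0 ≠ z by omega, show 1 ≠ z by omega])
    have ca : ∀ {y}, separatorColor z y = some .a → y = z := by
      intro y hy
      by_contra hne
      simp [separatorColor, hne] at hy
    have cb : ∀ {y}, separatorColor z y = some .b → y < 2 := by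
      intro y hy
      by_contra hne
      simp only [separatorColor, hne, if_false] at hy
      split_ifs at hy
      cases hy
    have hlen := congrArg List.length hlm
    simp only [List.length_map, altWord, List.length_cons, List.length_nil] at hlen
    rcases l with _ | ⟨z₁, _ | ⟨c₁, _ | ⟨z₂, _ | ⟨c₂, _ | ⟨z₃, _ | ⟨y, l⟩⟩⟩⟩⟩⟩ <;>
      simp only [List.length_cons, List.length_nil] at hlen
    any_goals omega
    simp only [List.map_cons, List.map_nil, altWord, expected, List.cons.injEq] at hlm
    obtain ⟨e1, e2, e3, e4, e5, -⟩ := hlm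
    obtain rfl : z₁ = z := ca e1
    obtain rfl : z₂ = z₁ := ca e3
    obtain rfl : z₃ = z₂ := ca e5
    have f2 : c₁ < 2 := cb e2
    have f4 : c₂ < 2 := cb e4
    have f1 : ¬ z₃ < 2 := by omega
    have hnil : ∀ G : List ℕ, (∀ y < 2, y ∉ G) → G.filter (fun y => y < 2) = [] := by
      intro G hG
      refine List.filter_eq_nil_iff.2 fun y hy => ?_
      have : ¬ y < 2 := fun hy2 => hG y hy2 hy
      simpa using this
    have hf := hl.filter (fun y => y < 2)
    rw [show [z₃, c₁, z₃, c₂, z₃].filter (fun y => y < 2) = [c₁, c₂] by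
        simp only [List.filter_cons, f1, f2, f4, decide_true, decide_false, if_true,
          Bool.false_eq_true, if_false, List.filter_nil],
      show (frame 2 G₀ G₁ G₂).filter (fun y => y < 2) = [0, 1] by
        simp only [frame, OfNat.ofNat_ne_one, if_false, List.filter_append, List.filter_cons,
          hnil G₀ fun y hy => (hs y hy).1, hnil G₁ fun y hy => (hs y hy).2.1,
          hnil G₂ fun y hy => (hs y hy).2.2]
        rfl] at hf
    have he := hf.eq_of_length rfl
    simp only [List.cons.injEq, and_true] at he
    obtain ⟨rfl, rfl⟩ := he
    simp only [frame, OfNat.ofNat_ne_one, if_false] at hl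
    have r0 := sublist_of_append_cons (p := [z₃]) (q := [z₃, 1, z₃]) (by simp; omega)
      (hs 0 (by omega)).1 (by
        simp [(hs 0 (by omega)).2.1, (hs 0 (by omega)).2.2]) hl
    have r1 := sublist_of_append_cons (p := [z₃]) (q := [z₃]) (by simp; omega)
      (hs 1 (by omega)).2.1 (hs 1 (by omega)).2.2 r0.2
    simp only [List.singleton_sublist] at r0 r1
    exact ⟨r0.1, r1.1, r1.2⟩

theorem same_of_zigzag (hk : k = 1 ∨ k = 2) {G₀ G₁ G₂ : List ℕ} (hG : k = 1 → G₂ = G₀) {x y : ℕ}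
    (hx : 2 ≤ x) (hy : 2 ≤ y) (h₁ : (zigzag x y (2 * k + 1)).Sublist (frame k G₀ G₁ G₂))
    (h₂ : (zigzag y x (2 * k + 1)).Sublist (frame k G₀ G₁ G₂))
    (h : ∀ h : Fin 3, Precedes (![G₀, G₁, G₂] h) x y ∨ Precedes (![G₀, G₁, G₂] h) y x) :
    (∀ h : Fin 3, Precedes (![G₀, G₁, G₂] h) x y) ∨
      ∀ h : Fin 3, Precedes (![G₀, G₁, G₂] h) y x := by
  have a0 : Precedes G₀ x y ∨ Precedes G₀ y x := h 0
  have a1 : Precedes G₁ x y ∨ Precedes G₁ y x := h 1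
  have a2 : Precedes G₂ x y ∨ Precedes G₂ y x := h 2
  have all : ∀ x y, Precedes G₀ x y → Precedes G₁ x y → Precedes G₂ x y →
      ∀ h : Fin 3, Precedes (![G₀, G₁, G₂] h) x y := by
    intro x y b0 b1 b2 h
    fin_cases h
    exacts [b0, b1, b2]
  rcases hk with rfl | rfl
  · obtain rfl := hG rfl
    rcases a0 with a0 | a0 <;> rcases a1 with a1 | a1
    · exact Or.inl (all x y a0 a1 a0)
    · exact (not_precedes_of_zigzag_one hx hy h₂ a0 a1).elim
    · exact (not_precedes_of_zigzag_one hy hx h₁ a0 a1).elim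
    · exact Or.inr (all y x a0 a1 a0)
  · rcases a0 with a0 | a0
    · have hc := not_precedes_of_zigzag_two hx hy h₂ a0
      rcases a1 with a1 | a1 <;> rcases a2 with a2 | a2
      · exact Or.inl (all x y a0 a1 a2)
      · exact (hc.2.2 a1 a2).elim
      · exact (hc.1 a1 a2).elim
      · exact (hc.2.1 a1 a2).elim
    · have hc := not_precedes_of_zigzag_two hy hx h₁ a0
      rcases a1 with a1 | a1 <;> rcases a2 with a2 | a2
      · exact (hc.2.1 a1 a2).elim
      · exact (hc.1 a1 a2).elim
      · exact (hc.2.2 a1 a2).elim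
      · exact Or.inr (all y x a0 a1 a2)

theorem SatisfiesList.not_zigzag_la (hk : k = 1 ∨ k = 2)
    (h : SatisfiesList (LeeMonoid (2 * k + 1)) (wordU k n) w) {i j : ℕ} (hij : i < j) :
    ¬ (zigzag (la j) (la i) (k + 2)).Sublist w := fun hs =>
  not_zigzag_wordU_la hk hij
    (h.symm.zigzag_sublist (by omega) (la_lt hij).ne' (by omega) hs)

theorem SatisfiesList.not_zigzag_lb (hk : k = 1 ∨ k = 2)
    (h : SatisfiesList (LeeMonoid (2 * k + 1)) (wordU k n) w) {i j : ℕ} (hij : i < j) :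
    ¬ (zigzag (lb j) (lb i) (k + 2)).Sublist w := fun hs =>
  not_zigzag_wordU_lb hk hij
    (h.symm.zigzag_sublist (by omega) (lb_lt hij).ne' (by omega) hs)

/-- Missing zigzags of length `k + 2` order each chain within the gaps; the zigzags of length `2k +
1` between the chains, present in both directions, exclude mixed orientations. -/
theorem SatisfiesList.gapSystem (hk : k = 1 ∨ k = 2)
    (h : SatisfiesList (LeeMonoid (2 * k + 1)) (wordU k n) w) : GapSystem n (gap k w) := by
  obtain ⟨G₀, G₁, G₂, rfl, hG, hs⟩ := h.exists_frame hk
  have hgap : gap k (frame k G₀ G₁ G₂) = ![G₀, G₁, G₂] := by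
    have := gap_frame hk (G₂ := G₂) (hs 0 (by omega)).1 (hs 1 (by omega)).2.1
    funext h
    fin_cases h
    · exact this.1
    · exact this.2.1
    · refine this.2.2.trans ?_
      split_ifs with h1
      exacts [(hG h1).symm, rfl]
  rw [hgap]
  have hA : ∀ i < n, la i ∈ G₀ ∧ la i ∈ G₁ ∧ la i ∈ G₂ := fun i hi =>
    mem_gaps hk h hG hs (Or.inl (la_mem_chainA hi))
  have hB : ∀ i < n, lb i ∈ G₀ ∧ lb i ∈ G₁ ∧ lb i ∈ G₂ := fun i hi =>
    mem_gaps hk h hG hs (Or.inr (lb_mem_chainB hi))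
  have weak : ∀ {z}, z ∈ G₀ ∧ z ∈ G₁ ∧ z ∈ G₂ → z ∈ G₀ ∧ z ∈ G₁ ∧ (k = 1 ∨ z ∈ G₂) :=
    fun hz => ⟨hz.1, hz.2.1, Or.inr hz.2.2⟩
  have strong : ∀ {x y}, Precedes G₀ x y ∧ Precedes G₁ y x ∧ (k = 1 ∨ Precedes G₂ x y) →
      Precedes G₀ x y ∧ Precedes G₁ y x ∧ Precedes G₂ x y := fun hz =>
    ⟨hz.1, hz.2.1, hz.2.2.elim (fun h1 => hG h1 ▸ hz.1) id⟩
  have cA : ∀ i j, i < j → j < n → _ := fun i j hij hj =>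
    strong (precedes_of_not_zigzag hk (weak (hA i (hij.trans hj))) (weak (hA j hj))
      (h.not_zigzag_la hk hij))
  have cB : ∀ i j, i < j → j < n → _ := fun i j hij hj =>
    strong (precedes_of_not_zigzag hk (weak (hB i (hij.trans hj))) (weak (hB j hj))
      (h.not_zigzag_lb hk hij))
  have zz : ∀ i < n, ∀ j < n, _ := fun i hi j hj => zigzag_wordU (k := k) hk hi hj
  exact
    { la_mem := by
        intro h i hi
        fin_cases h
        exacts [(hA i hi).1, (hA i hi).2.1, (hA i hi).2.2]
      lb_mem := by
        intro h i hi
        fin_cases h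
        exacts [(hB i hi).1, (hB i hi).2.1, (hB i hi).2.2]
      la_zero := fun i j hij hj => (cA i j hij hj).1
      la_one := fun i j hij hj => (cA i j hij hj).2.1
      la_two := fun i j hij hj => (cA i j hij hj).2.2
      lb_zero := fun i j hij hj => (cB i j hij hj).1
      lb_one := fun i j hij hj => (cB i j hij hj).2.1
      lb_two := fun i j hij hj => (cB i j hij hj).2.2
      same := fun i hi j hj => same_of_zigzag hk hG (by simp [la]) (by simp [lb])
        (h.zigzag_sublist (by omega) (la_ne_lb i j) le_rfl
          ((zigzag_sublist_zigzag _ _ (by omega)).trans (zz i hi j hj)))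
        (h.zigzag_sublist (by omega) (la_ne_lb i j).symm le_rfl
          ((zigzag_swap_sublist _ _ _).trans (zz i hi j hj))) }

end Equivalent

/-! ### Deduction steps -/

/-- A letter is free for the substitution `φ` in `s` if it does not occur in the value of a letter
that occurs more than `k` times in `s`. -/
def isFree (k : ℕ) (s : List ℕ) (φ : ℕ → List ℕ) (z : ℕ) : Bool :=
  decide (∀ v ∈ s, k < s.count v → z ∉ φ v)

/-- Free letters come only from values of low letters of `s`, and `s` and `t` have the same low
word. -/
theorem filter_isFree_flatMap {k : ℕ} {s t : List ℕ} (h : LowEquiv k s t) (φ : ℕ → List ℕ) :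
    (s.flatMap φ).filter (isFree k s φ) = (t.flatMap φ).filter (isFree k s φ) := by
  rw [List.filter_flatMap, List.filter_flatMap]
  have nil : ∀ v ∈ s, k < s.count v → (φ v).filter (isFree k s φ) = [] := by
    intro v hv hc
    refine List.filter_eq_nil_iff.2 fun z hz hfree => ?_
    exact (of_decide_eq_true hfree) v hv hc hz
  have hs := flatMap_filter_of_eq_nil (φ := fun v => (φ v).filter (isFree k s φ))
    (p := fun x => s.count x ≤ k) (s := s) fun v hv hp => nil v hv (by simpa using hp)
  have ht := flatMap_filter_of_eq_nil (φ := fun v => (φ v).filter (isFree k s φ))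
    (p := fun x => t.count x ≤ k) (s := t) fun v hv hp => nil v ((h.1 v).2 hv) (by
      have := h.count_le_iff v
      simp only [decide_eq_false_iff_not] at hp
      omega)
  rw [← hs, ← ht]
  exact congrArg (fun l => List.flatMap (fun v => (φ v).filter (isFree k s φ)) l) h.2

/-- Each of `k + 1` copies of `φ v` supplies the same pair `xy` or `yx`; even `(xy)^{k+1}` contains
`yxy⋯` of length `2k + 1 ≥ k + 2`. As `wordU` has no such zigzag within a chain, a high letter's
value meets each chain at most once. -/
theorem zigzag_sublist_flatMap_replicate {k : ℕ} (hk : k = 1 ∨ k = 2) {φ : ℕ → List ℕ}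
    {x y v : ℕ} (hxy : x ≠ y) (hx : x ∈ φ v) (hy : y ∈ φ v) {s : List ℕ} (hs : k < s.count v) :
    (zigzag y x (k + 2)).Sublist (s.flatMap φ) := by
  refine List.Sublist.trans ?_ ((List.replicate_sublist_iff.2 hs).flatMap φ)
  have h2 : [x, y].Sublist (φ v) ∨ [y, x].Sublist (φ v) := by
    obtain ⟨i, hi⟩ := List.mem_iff_getElem?.1 hx
    obtain ⟨j, hj⟩ := List.mem_iff_getElem?.1 hy
    rcases lt_trichotomy i j with hij | rfl | hij
    · exact Or.inl (pair_sublist_iff.2 ⟨i, j, hij, hi, hj⟩)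
    · exact absurd (Option.some.inj (hi.symm.trans hj)) hxy
    · exact Or.inr (pair_sublist_iff.2 ⟨j, i, hij, hj, hi⟩)
  rcases hk with rfl | rfl <;> rcases h2 with h2 | h2 <;>
    simp only [List.replicate, List.flatMap_cons, List.flatMap_nil, List.append_nil]
  · exact List.Sublist.trans (by simp [zigzag]) (h2.append h2)
  · exact List.Sublist.trans (by simp [zigzag]) (h2.append h2)
  · exact List.Sublist.trans (by simp [zigzag]) (h2.append (h2.append h2))
  · exact List.Sublist.trans (by simp [zigzag]) (h2.append (h2.append h2))

/-- If every value of a letter of high multiplicity contains at most one of the letters `f i`, then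
all but `s.length` of these letters are free. -/
theorem exists_strictMono_isFree {k n : ℕ} {s : List ℕ} {φ : ℕ → List ℕ} {f : ℕ → ℕ}
    (hf : ∀ v, k < s.count v → ∀ i j, i < j → f i ∈ φ v → f j ∉ φ v) (hn : s.length + 4 ≤ n) :
    ∃ e : Fin 4 → ℕ, StrictMono e ∧ ∀ x, e x < n ∧ isFree k s φ (f (e x)) := by
  let S := (Finset.range n).filter fun i => ¬ isFree k s φ (f i)
  let T := (Finset.range n).filter fun i => isFree k s φ (f i)
  have hS : ∀ i ∈ S, ∃ v ∈ s, k < s.count v ∧ f i ∈ φ v := by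
    intro i hi
    simpa [S, isFree] using (Finset.mem_filter.1 hi).2
  choose! g hg using hS
  -- Each high letter of `s` spoils at most one index, so non-free indices inject into the letters
  -- of `s`.
  have hcard : S.card ≤ s.length := by
    refine le_trans (Finset.card_le_card_of_injOn g (t := s.toFinset)
      (fun i hi => List.mem_toFinset.2 (hg i hi).1) ?_) (List.toFinset_card_le s)
    intro i hi j hj hij
    by_contra hne
    have gi := hg i hi
    have gj := hg j hj
    rcases lt_or_gt_of_ne hne with hl | hl
    · exact hf _ gi.2.1 i j hl gi.2.2 (hij ▸ gj.2.2)
    · exact hf _ gj.2.1 j i hl gj.2.2 (hij ▸ gi.2.2)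
  have hsum : T.card + S.card = n := by
    rw [Finset.card_filter_add_card_filter_not, Finset.card_range]
  have hT : 4 ≤ T.card := by omega
  refine ⟨T.orderEmbOfCardLe hT, (T.orderEmbOfCardLe hT).strictMono, fun x => ?_⟩
  simpa [T] using T.orderEmbOfCardLe_mem hT x

/-- The invariant of deductions from `wordU k n`: in each gap some letter of the first chain
precedes some letter of the second one. -/
def FirstChainFirst (k n : ℕ) (w : List ℕ) : Prop :=
  SatisfiesList (LeeMonoid (2 * k + 1)) (wordU k n) w ∧
    ∃ i < n, ∃ j < n, ∀ h, Precedes (gap k w h) (la i) (lb j)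

theorem FirstChainFirst.step {k n : ℕ} (hk : k = 1 ∨ k = 2) {s t p q : List ℕ} {φ : ℕ → List ℕ}
    (hst : SatisfiesList (LeeMonoid (2 * k + 1)) s t) (hn : s.length + 4 ≤ n)
    (h : FirstChainFirst k n (p ++ s.flatMap φ ++ q)) :
    FirstChainFirst k n (p ++ t.flatMap φ ++ q) := by
  obtain ⟨hU, i, hi, j, hj, hij⟩ := h
  refine ⟨hU.trans ((hst.flatMap φ).append p q), ?_⟩
  have hsub : (s.flatMap φ).Sublist (p ++ s.flatMap φ ++ q) :=
    (List.sublist_append_right _ _).trans (List.sublist_append_left _ _)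
  have fA : ∀ v, k < s.count v → ∀ i j, i < j → la i ∈ φ v → la j ∉ φ v :=
    fun v hv i j hij hi hj => hU.not_zigzag_la hk hij
      ((zigzag_sublist_flatMap_replicate hk (la_lt hij).ne hi hj hv).trans hsub)
  have fB : ∀ v, k < s.count v → ∀ i j, i < j → lb i ∈ φ v → lb j ∉ φ v :=
    fun v hv i j hij hi hj => hU.not_zigzag_lb hk hij
      ((zigzag_sublist_flatMap_replicate hk (lb_lt hij).ne hi hj hv).trans hsub)
  obtain ⟨f, hf, hf'⟩ := exists_strictMono_isFree fA hn
  obtain ⟨g, hg, hg'⟩ := exists_strictMono_isFree fB hn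
  -- Within the value of a high letter a separator would occur more than `k` times, but it occurs at
  -- most once.
  have hsep : ∀ z < 2, isFree k s φ z := by
    intro z hz
    refine decide_eq_true fun v _ hc hzv => ?_
    have h1 := count_le_count_flatMap hzv s
    have h2 := hsub.count_le z
    have h3 := hU.count_separators hk
    interval_cases z <;> omega
  have hfilter : (p ++ s.flatMap φ ++ q).filter (isFree k s φ) =
      (p ++ t.flatMap φ ++ q).filter (isFree k s φ) := by
    simp only [List.filter_append, filter_isFree_flatMap ((discriminates_lee hk).lowEquiv hst) φ]
  have H := hU.gapSystem hk
  -- The old witnesses need not be free. They fix the orientation through `not_both`, and a free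
  -- pair carries it across the step.
  obtain ⟨x, y, hxy | hxy⟩ := H.exists_same hf hg (fun x => (hf' x).1) (fun x => (hg' x).1)
  · refine ⟨f x, (hf' x).1, g y, (hg' y).1, fun h => ?_⟩
    rw [← precedes_filter_iff (hf' x).2 (hg' y).2, ← gap_filter (hsep 0 (by omega))
      (hsep 1 (by omega)), ← hfilter, gap_filter (hsep 0 (by omega)) (hsep 1 (by omega)),
      precedes_filter_iff (hf' x).2 (hg' y).2]
    exact hxy h
  · exact (H.not_both hi hj (hf' x).1 (hg' y).1 hij hxy).elim

/-- Quantifying over all contexts turns the invariant into a congruence. Both directions are needed,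
so both sides of each identity must be short. -/
theorem firstChainFirst_iff_of_deducible {k n : ℕ} (hk : k = 1 ∨ k = 2)
    {E : Set (FreeSemigroup ℕ × FreeSemigroup ℕ)}
    (hE : ∀ p ∈ E, Satisfies (LeeMonoid (2 * k + 1)) p.1 p.2)
    (hn : ∀ p ∈ E, (letters p.1).length + 4 ≤ n ∧ (letters p.2).length + 4 ≤ n)
    {u v : FreeSemigroup ℕ} (h : Deducible E u v) :
    FirstChainFirst k n (letters u) ↔ FirstChainFirst k n (letters v) := by
  let c : Con (FreeSemigroup ℕ) :=
    { r := fun u v => ∀ p q, FirstChainFirst k n (p ++ letters u ++ q) ↔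
        FirstChainFirst k n (p ++ letters v ++ q)
      iseqv := ⟨fun _ _ _ => Iff.rfl, fun h p q => (h p q).symm,
        fun h h' p q => (h p q).trans (h' p q)⟩
      mul' := by
        intro u v u' v' h h' p q
        have h1 := h p (letters u' ++ q)
        have h2 := h' (p ++ letters v) q
        simp only [letters_mul, List.append_assoc] at h1 h2 ⊢
        exact h1.trans h2 }
  have hle : conGen (SubstInstance E) ≤ c := by
    refine Con.conGen_le.2 ?_
    rintro u v ⟨p, hp, θ, rfl, rfl⟩ P Q
    rw [letters_lift, letters_lift]
    have hs := satisfies_iff.1 (hE p hp)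
    exact ⟨FirstChainFirst.step hk hs (hn p hp).1, FirstChainFirst.step hk hs.symm (hn p hp).2⟩
  simpa using hle h [] []

theorem not_finitelyBased_lee {k : ℕ} (hk : k = 1 ∨ k = 2) :
    ¬ FinitelyBased (LeeMonoid (2 * k + 1)) := by
  rintro ⟨E, hfin, hE, hded⟩
  obtain ⟨N, hN⟩ := (hfin.image fun p =>
    (letters p.1).length + (letters p.2).length).bddAbove
  have hn : ∀ p ∈ E, (letters p.1).length + 4 ≤ N + 4 ∧ (letters p.2).length + 4 ≤ N + 4 := by
    intro p hp
    have : (letters p.1).length + (letters p.2).length ≤ N := hN ⟨p, hp, rfl⟩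
    omega
  obtain ⟨u, hu⟩ := exists_letters_eq (l := wordU k (N + 4)) (by simp [wordU, frame])
  obtain ⟨v, hv⟩ := exists_letters_eq (l := wordV k (N + 4)) (by simp [wordV, frame])
  have hUV := satisfiesList_wordU_wordV hk (N + 4)
  have hdec := hded u v (satisfies_iff.2 (by rwa [hu, hv]))
  have hiff := firstChainFirst_iff_of_deducible hk hE hn hdec
  rw [hu, hv] at hiff
  have gU := gap_frame hk (G₂ := chainA (N + 4) ++ chainB (N + 4))
    (G₀ := chainA (N + 4) ++ chainB (N + 4))
    (G₁ := (chainA (N + 4)).reverse ++ (chainB (N + 4)).reverse)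
    (by simp [notMem_chainA_of_lt_two, notMem_chainB_of_lt_two])
    (by simp [notMem_chainA_of_lt_two, notMem_chainB_of_lt_two])
  have gV := gap_frame hk (G₂ := chainB (N + 4) ++ chainA (N + 4))
    (G₀ := chainB (N + 4) ++ chainA (N + 4))
    (G₁ := (chainB (N + 4)).reverse ++ (chainA (N + 4)).reverse)
    (by simp [notMem_chainA_of_lt_two, notMem_chainB_of_lt_two])
    (by simp [notMem_chainA_of_lt_two, notMem_chainB_of_lt_two])
  have hA := la_notMem_chainB (N + 4) 0
  have hB := lb_notMem_chainA (N + 4) 0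
  have invU : FirstChainFirst k (N + 4) (wordU k (N + 4)) := by
    refine ⟨fun _ => rfl, 0, by omega, 0, by omega, fun h => ?_⟩
    rw [wordU]
    fin_cases h
    · change Precedes (gap k _ 0) _ _
      rw [gU.1]
      exact precedes_append hA hB
    · change Precedes (gap k _ 1) _ _
      rw [gU.2.1]
      exact precedes_append (by simpa using hA) (by simpa using hB)
    · change Precedes (gap k _ 2) _ _
      rw [gU.2.2.trans (ite_self _)]
      exact precedes_append hA hB
  obtain ⟨-, i, hi, j, hj, hij⟩ := hiff.1 invU
  -- In every gap of `wordV` the letter `lb 0` precedes `la 0`, the opposite orientation.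
  refine (hUV.gapSystem hk).not_both hi hj (k := 0) (j := 0) (by omega) (by omega) hij fun h => ?_
  rw [wordV]
  fin_cases h
  · change Precedes (gap k _ 0) _ _
    rw [gV.1]
    exact precedes_append hB hA
  · change Precedes (gap k _ 1) _ _
    rw [gV.2.1]
    exact precedes_append (by simpa using hB) (by simpa using hA)
  · change Precedes (gap k _ 2) _ _
    rw [gV.2.2.trans (ite_self _)]
    exact precedes_append hB hA

end Lee

theorem mainTheorem3 :
    (¬ Lee.FinitelyBased (Lee.LeeMonoid 3) ∧
      ¬ Lee.FinitelyBased (Lee.LeeMonoid 5)) ∧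
    (Lee.FinitelyBasedWords (Lee.iso (Lee.LeeMonoid 3)) ∧
      Lee.FinitelyBasedWords (Lee.iso (Lee.LeeMonoid 5))) ∧
    Lee.EquationallyEquivalent (Lee.iso (Lee.LeeMonoid 3))
      {Lee.wa * Lee.wb} ∧
    Lee.EquationallyEquivalent (Lee.iso (Lee.LeeMonoid 5))
      {Lee.wa * Lee.wb * Lee.wa * Lee.wb,
        Lee.wa ^ 2 * Lee.wb ^ 2,
        Lee.wa * Lee.wb ^ 2 * Lee.wa} := by
  rw [show Lee.iso (Lee.LeeMonoid 3) = Lee.boundedWords 1 from Lee.iso_lee (Or.inl rfl),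
    show Lee.iso (Lee.LeeMonoid 5) = Lee.boundedWords 2 from Lee.iso_lee (Or.inr rfl)]
  refine ⟨⟨Lee.not_finitelyBased_lee (Or.inl rfl), Lee.not_finitelyBased_lee (Or.inr rfl)⟩,
    ⟨Lee.finitelyBased_of_lowEquiv (Or.inl rfl) fun _ _ => Lee.satisfiesList_boundedWords_iff,
      Lee.finitelyBased_of_lowEquiv (Or.inr rfl) fun _ _ => Lee.satisfiesList_boundedWords_iff⟩,
    Lee.equationallyEquivalent_of_lowEquiv (fun _ _ => Lee.satisfiesList_boundedWords_iff)
      fun _ _ => Lee.satisfiesList_rees_iff (fun _ => Lee.count_le_of_mem_one)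
        Lee.pairComplete_one,
    Lee.equationallyEquivalent_of_lowEquiv (fun _ _ => Lee.satisfiesList_boundedWords_iff)
      fun _ _ => Lee.satisfiesList_rees_iff (fun _ => Lee.count_le_of_mem_two)
        Lee.pairComplete_two⟩
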